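/- **Setting.** Fix $N$ agents and a horizon $T$. For $t\in\{1,\dots,T\}$ and $i\in\{1,\dots,N\}$ let the state spaces $\mathcal X_1,\dots,\mathcal X_{T+1}$, the action spaces $\mathcal U^i_t$, the observation spaces $\mathcal Y^i_t$ and the noise spaces $\mathcal W^0_t,\mathcal W^i_t$ be Polish spaces. The primitive random variables $X_1,\ W^0_t,\ W^i_t$ are mutually independent with given laws. The system evolves by $$X_{t+1}=f_t(X_{1:t},U^{1:N}_{1:t},W^0_t),\qquad Y^i_t=h^i_t(X_{1:t},U^{1:N}_{1:t-1},W^i_t).$$ Agent $i$ at time $t$ knows only $Y^i_t$ (observations are not shared and past observations are not recalled). A behavioral strategy of agent $i$ at time $t$ is a Markov kernel $\pi^i_t(du\mid y)$ from $\mathcal Y^i_t$ to $\mathcal U^i_t$; it is deterministic if $\pi^i_t(\cdot\mid y)=\delta_{\gamma^i_t(y)}$ for a Borel map $\gamma^i_t:\mathcal Y^i_t\to\mathcal U^i_t$. The agents randomize independently. The team has a cost $\tilde c(x_{1:T+1},y^{1:N}_{1:T},u^{1:N}_{1:T})\in[0,\infty)$. Write $\omega_0=(x_1,w^0_{1:T})\in\Omega_0$;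 substituting the dynamics recursively turns $\tilde c$ into a function $c(\omega_0,y^{1:N}_{1:T},u^{1:N}_{1:T})$. The expected cost $J(\pi)\in[0,\infty]$ of a profile $\pi=(\pi^i_t)$ is the expectation of $c$ under the law that $\pi$ induces. For topological spaces $A,B$, a function $\phi:A\times B\to[0,\infty)$ is in class $IC(A,B)$ if at least one of the following holds: (i) for every $M>0$ and every compact $K\subset A$ there is a compact $L\subset B$ with $\inf_{K\times L^{\complement}}\phi\ge M$; (ii) for every $M>0$ and every $a\in A$ there are an open neighborhood $O$ of $a$ and a compact $L\subset B$ with $\inf_{O\times L^{\complement}}\phi\ge M$. (Here $\inf\emptyset=+\infty$.) **Theorem.** Assume the following. 1. All $f_t$, all $h^i_t$ and $\tilde c$ are continuous. 2. There is a profile $\tilde\pi$ of behavioral strategies with $J(\tilde\pi)<\infty$. 3. For all $i,t$ there are a probability measure $\nu^i_t$ on $\mathcal Y^i_t$ and a continuous, everywhere strictly positive function $\varphi^i_t(y^i_t;\omega_0,u^{1:N}_{1:t-1})$ such that, for all $\omega_0$, all $u^{1:N}_{1:t-1}$ and all Borel $S\subset\mathcal Y^i_t$, $$\Pr\big(Y^i_t\in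 S\mid\omega_0,u^{1:N}_{1:t-1}\big)=\int_S\varphi^i_t(y;\omega_0,u^{1:N}_{1:t-1})\,\nu^i_t(dy),$$ where the left side is the probability, under the law of $W^i_t$, that $h^i_t$, evaluated at the states determined by $(\omega_0,u^{1:N}_{1:t-1})$, lies in $S$. 4. The cost has the form $$c=\sum_{t=1}^T\sum_{i=1}^N c^i_t\big(u^i_t,\omega_0,u^{1:N}_{1:t-1},y^{1:N}_{1:t-1},y^i_t\big)+\kappa\big(\omega_0,y^{1:N}_{1:T},u^{1:N}_{1:T}\big),$$ where each $c^i_t$ is non-negative, continuous and in class $IC\big(\Omega_0\times\mathcal U^{1:N}_{1:t-1}\times\mathcal Y^{1:N}_{1:t-1}\times\mathcal Y^i_t,\ \mathcal U^i_t\big)$, and $\kappa$ is non-negative and continuous. Then there is a profile of deterministic strategies $\gamma^i_t$ that is team-optimal: its expected cost is equal to $\inf_\pi J(\pi)$, the infimum being over all profiles of behavioral strategies. -/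

import Mathlib

open MeasureTheory ProbabilityTheory
open scoped ENNReal NNReal

/-- The product `A 0 × ⋯ × A (n - 1)` of the first `n` members of a finite family of types. -/
abbrev Upto {m : ℕ} (A : Fin m → Type*) (n : ℕ) (hn : n ≤ m) :=
  ∀ s : Fin n, A (s.castLE hn)

/-- The first `n` coordinates of a point of the full product. -/
def truncate {m : ℕ} {A : Fin m → Type*} (a : ∀ s, A s) (n : ℕ) (hn : n ≤ m) : Upto A n hn :=
  fun s => a (s.castLE hn)

/-- The class `IC(A, B)`: a non-negative `φ` on `A × B` that is coercive in the second variable,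
either uniformly over compact sets of first variables, or locally uniformly in the first variable.
(The infimum over the empty set is `+∞`.) -/
def ClassIC {A B : Type*} [TopologicalSpace A] [TopologicalSpace B] (φ : A × B → ℝ≥0) : Prop :=
  (∀ M : ℝ≥0, 0 < M → ∀ K : Set A, IsCompact K →
      ∃ L : Set B, IsCompact L ∧ ∀ a ∈ K, ∀ b ∈ Lᶜ, M ≤ φ (a, b)) ∨
  (∀ M : ℝ≥0, 0 < M → ∀ a₀ : A,
      ∃ O : Set A, IsOpen O ∧ a₀ ∈ O ∧
        ∃ L : Set B, IsCompact L ∧ ∀ a ∈ O, ∀ b ∈ Lᶜ, M ≤ φ (a, b))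

/-- Data of a sequential dynamic team with `N` agents and `T` time steps. Time is indexed from `0`,
so the states are `x 0, …, x T`. The primitive random variables (initial state, actuation noises,
observation noises) are independent, with the laws recorded here. -/
structure DynamicTeam (N T : ℕ) (X : Fin (T + 1) → Type*) (U Y : Fin T → Fin N → Type*)
    (W₀ : Fin T → Type*) (W : Fin T → Fin N → Type*)
    [MeasurableSpace (X 0)] [∀ t, MeasurableSpace (W₀ t)] [∀ t i, MeasurableSpace (W t i)] where
  /-- `x (t + 1) = dyn t (x 0, …, x t) (u 0, …, u t) (w₀ t)`, where `u s` lists all the agents'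
  actions at time `s`. -/
  dyn : ∀ t : Fin T, Upto X (t + 1) (Nat.le_succ_of_le t.2) →
    Upto (fun s => ∀ i, U s i) (t + 1) t.2 → W₀ t → X t.succ
  /-- `y t i = obs t i (x 0, …, x t) (u 0, …, u (t - 1)) (w t i)`. -/
  obs : ∀ (t : Fin T) (i : Fin N), Upto X (t + 1) (Nat.le_succ_of_le t.2) →
    Upto (fun s => ∀ i, U s i) t t.2.le → W t i → Y t i
  /-- The cost of a realization of all states, observations and actions. -/
  cost : (∀ s, X s) → (∀ t i, Y t i) → (∀ t i, U t i) → ℝ≥0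
  lawX : ProbabilityMeasure (X 0)
  lawW₀ : ∀ t, ProbabilityMeasure (W₀ t)
  lawW : ∀ t i, ProbabilityMeasure (W t i)

namespace DynamicTeam

section Spaces

variable {N T : ℕ} {X : Fin (T + 1) → Type*} {U Y : Fin T → Fin N → Type*}
  {W₀ : Fin T → Type*} {W : Fin T → Fin N → Type*}

/-- The space `Ω₀` of the initial state and all actuation noises. -/
abbrev Omega (X : Fin (T + 1) → Type*) (W₀ : Fin T → Type*) := X 0 × (∀ t, W₀ t)

/-- A behavioral strategy profile without observation sharing: agent `i` at time `t` randomizes its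
action `u t i` on the basis of `y t i` only. -/
abbrev Strategy (Y U : Fin T → Fin N → Type*)
    [∀ t i, MeasurableSpace (Y t i)] [∀ t i, MeasurableSpace (U t i)] :=
  ∀ (t : Fin T) (i : Fin N), {κ : Kernel (Y t i) (U t i) // IsMarkovKernel κ}

/-- The behavioral strategy profile induced by a deterministic one. -/
noncomputable def Strategy.ofDeterministic
    [∀ t i, MeasurableSpace (Y t i)] [∀ t i, MeasurableSpace (U t i)]
    (γ : ∀ t i, Y t i → U t i) (hγ : ∀ t i, Measurable (γ t i)) : Strategy Y U :=
  fun t i => ⟨Kernel.deterministic (γ t i) (hγ t i), inferInstance⟩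

variable [MeasurableSpace (X 0)] [∀ t, MeasurableSpace (W₀ t)] [∀ t i, MeasurableSpace (W t i)]

/-- The states `x 0, …, x n`, obtained by unrolling the dynamics from the initial state, the first
`n` actuation noises and the first `n` joint actions. -/
def states (D : DynamicTeam N T X U Y W₀ W) (x : X 0) : (n : ℕ) → (hn : n ≤ T) →
    Upto W₀ n hn → Upto (fun s => ∀ i, U s i) n hn → Upto X (n + 1) (Nat.succ_le_succ hn)
  | 0, _, _, _ => Fin.snoc (α := fun s : Fin 1 => X (s.castLE _)) (fun s => s.elim0) x
  | n + 1, hn, w, u =>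
    Fin.snoc (α := fun s : Fin (n + 2) => X (s.castLE _))
      (D.states x n (Nat.le_of_succ_le hn) (fun s => w s.castSucc) (fun s => u s.castSucc))
      (D.dyn ⟨n, hn⟩
        (D.states x n (Nat.le_of_succ_le hn) (fun s => w s.castSucc) (fun s => u s.castSucc))
        u (w (Fin.last n)))

/-- The observation `y t i` as a function of `ω₀`, the past joint actions, and the noise `w t i`. -/
def redObs (D : DynamicTeam N T X U Y W₀ W) (t : Fin T) (i : Fin N) (ω : Omega X W₀)
    (u : Upto (fun s => ∀ i, U s i) t t.2.le) (w : W t i) : Y t i :=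
  D.obs t i (D.states ω.1 t t.2.le (truncate ω.2 t t.2.le) u) u w

/-- The cost as a function of `ω₀`, all observations and all actions. -/
def redCost (D : DynamicTeam N T X U Y W₀ W) (ω : Omega X W₀)
    (y : ∀ t i, Y t i) (u : ∀ t i, U t i) : ℝ≥0 :=
  D.cost (D.states ω.1 T le_rfl ω.2 u) y u

/-- The law of `ω₀`. -/
noncomputable def omegaLaw (D : DynamicTeam N T X U Y W₀ W) : Measure (Omega X W₀) :=
  (D.lawX : Measure (X 0)).prod (Measure.pi fun t => (D.lawW₀ t : Measure (W₀ t)))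

variable [∀ t i, MeasurableSpace (U t i)] [∀ t i, MeasurableSpace (Y t i)]

/-- The conditional law of `y t i` given `ω₀` and the past joint actions. -/
noncomputable def obsLaw (D : DynamicTeam N T X U Y W₀ W) (t : Fin T) (i : Fin N)
    (ω : Omega X W₀) (u : Upto (fun s => ∀ i, U s i) t t.2.le) : Measure (Y t i) :=
  (D.lawW t i : Measure (W t i)).map (D.redObs t i ω u)

/-- The conditional law of all observations and actions of time `t`, given `ω₀` and the past joint
actions, when the agents use the profile `π`. -/
noncomputable def stageLaw (D : DynamicTeam N T X U Y W₀ W) (π : Strategy Y U) (t : Fin T)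
    (ω : Omega X W₀) (u : Upto (fun s => ∀ i, U s i) t t.2.le) :
    Measure (∀ i, Y t i × U t i) :=
  Measure.pi fun i => D.obsLaw t i ω u ⊗ₘ (π t i).1

/-- The joint law of `ω₀` and the observations and actions of the first `n` time steps, when the
agents use the profile `π`. -/
noncomputable def jointLaw (D : DynamicTeam N T X U Y W₀ W) (π : Strategy Y U) :
    (n : ℕ) → (hn : n ≤ T) →
      Measure (Omega X W₀ × Upto (fun s => ∀ i, Y s i) n hn × Upto (fun s => ∀ i, U s i) n hn)
  | 0, _ => D.omegaLaw.map fun ω => (ω, fun s => s.elim0, fun s => s.elim0)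
  | n + 1, hn =>
    (D.jointLaw π n (Nat.le_of_succ_le hn)).bind fun p =>
      (D.stageLaw π ⟨n, hn⟩ p.1 p.2.2).map fun z =>
        (p.1,
          Fin.snoc (α := fun s : Fin (n + 1) => ∀ i, Y (s.castLE hn) i) p.2.1 fun i => (z i).1,
          Fin.snoc (α := fun s : Fin (n + 1) => ∀ i, U (s.castLE hn) i) p.2.2 fun i => (z i).2)

/-- The expected cost `J` of a behavioral strategy profile. -/
noncomputable def expectedCost (D : DynamicTeam N T X U Y W₀ W) (π : Strategy Y U) : ℝ≥0∞ :=
  ∫⁻ p, (D.redCost p.1 p.2.1 p.2.2 : ℝ≥0∞) ∂(D.jointLaw π T le_rfl)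

/-- A profile is team-optimal if no behavioral strategy profile has a smaller expected cost. -/
def IsTeamOptimal (D : DynamicTeam N T X U Y W₀ W) (π : Strategy Y U) : Prop :=
  ∀ π' : Strategy Y U, D.expectedCost π ≤ D.expectedCost π'

end Spaces

/-- The state transition, observation and cost functions are jointly continuous. -/
structure IsContinuous {N T : ℕ} {X : Fin (T + 1) → Type*} {U Y : Fin T → Fin N → Type*}
    {W₀ : Fin T → Type*} {W : Fin T → Fin N → Type*}
    [MeasurableSpace (X 0)] [∀ t, MeasurableSpace (W₀ t)] [∀ t i, MeasurableSpace (W t i)]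
    [∀ s, TopologicalSpace (X s)] [∀ t i, TopologicalSpace (U t i)]
    [∀ t i, TopologicalSpace (Y t i)] [∀ t, TopologicalSpace (W₀ t)]
    [∀ t i, TopologicalSpace (W t i)]
    (D : DynamicTeam N T X U Y W₀ W) : Prop where
  dyn : ∀ t : Fin T, Continuous fun p : Upto X (t + 1) (Nat.le_succ_of_le t.2) ×
    Upto (fun s => ∀ i, U s i) (t + 1) t.2 × W₀ t => D.dyn t p.1 p.2.1 p.2.2
  obs : ∀ (t : Fin T) (i : Fin N), Continuous fun p : Upto X (t + 1) (Nat.le_succ_of_le t.2) ×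
    Upto (fun s => ∀ i, U s i) t t.2.le × W t i => D.obs t i p.1 p.2.1 p.2.2
  cost : Continuous fun p : (∀ s, X s) × (∀ t i, Y t i) × (∀ t i, U t i) =>
    D.cost p.1 p.2.1 p.2.2

end DynamicTeam

/-!
The proof replaces the dynamic team by an equivalent static one. Since the observation kernels have
densities with respect to fixed laws `ν t i`, the law of a history under a profile `π` has the
density `dens`, the product of all observation densities, with respect to the law under which `ω₀`
and the pairs `(y t i, u t i)` are independent, with `(y t i, u t i)` of law `ν t i ⊗ₘ π t i`
(`HasObsDensity.lintegral_jointLaw`). Hence the expected cost is the integral of the continuous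
function `staticCost` (the cost times `dens`) against a product measure, and a profile enters only
through the laws `pairLaw` of the individual pairs.

These laws are the topological parameters. The integral of a non-negative continuous function
against a product of laws is lower semicontinuous for weak convergence. The laws that come from
profiles with expected cost at most `B` are tight (`HasObsDensity.isTightMeasureSet_pairLaw`), by
induction on time: given tightness of the past, the strictly positive continuous density is bounded
below on a large compact set, and there the coercive cost term keeps the action in a compact set. By
Prokhorov's theorem the sublevel set is compact, so that a minimizer exists; a disintegration turns
it into a behavioral profile (`HasObsDensity.exists_isTeamOptimal`).

Finally, a Markov kernel to a standard Borel space is a deterministic function of the observation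
and an independent uniform variable. So the cost of a behavioral profile is an average of costs of
deterministic profiles, and some deterministic profile does at least as well
(`HasObsDensity.exists_deterministic_le`). No measurable selection theorem is needed.
-/

/-! ### Products of measures, tightness and semicontinuity -/

theorem lintegral_pi_prod_eq {ι : Type*} [Fintype ι] {α : ι → Type*} [∀ i, MeasurableSpace (α i)]
    (μ : ∀ i, Measure (α i)) [∀ i, IsProbabilityMeasure (μ i)] (f : ∀ i, α i → ℝ≥0∞)
    (hf : ∀ i, Measurable (f i)) :
    ∫⁻ x, ∏ i, f i (x i) ∂Measure.pi μ = ∏ i, ∫⁻ a, f i a ∂μ i := by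
  have h := iIndepFun_pi (μ := μ) (X := f) fun i => (hf i).aemeasurable
  rw [lintegral_prod_eq_prod_lintegral_of_indepFun Finset.univ _ h
    fun i => (hf i).comp (measurable_pi_apply i)]
  refine Finset.prod_congr rfl fun i _ => ?_
  rw [← (measurePreserving_eval μ i).lintegral_comp (hf i)]

theorem pi_withDensity_eq {ι : Type*} [Fintype ι] {α : ι → Type*} [∀ i, MeasurableSpace (α i)]
    (μ : ∀ i, Measure (α i)) [∀ i, IsProbabilityMeasure (μ i)] (f : ∀ i, α i → ℝ≥0∞)
    (hf : ∀ i, Measurable (f i)) [∀ i, SigmaFinite ((μ i).withDensity (f i))] :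
    Measure.pi (fun i => (μ i).withDensity (f i)) =
      (Measure.pi μ).withDensity fun x => ∏ i, f i (x i) := by
  refine Measure.pi_eq fun s hs => ?_
  rw [withDensity_apply _ (MeasurableSet.univ_pi hs),
    ← lintegral_indicator (MeasurableSet.univ_pi hs)]
  have : ∀ x, (Set.pi Set.univ s).indicator (fun x => ∏ i, f i (x i)) x =
      ∏ i, (s i).indicator (f i) (x i) := by
    intro x
    by_cases hx : x ∈ Set.pi Set.univ s
    · rw [Set.indicator_of_mem hx]
      exact Finset.prod_congr rfl fun i _ => (Set.indicator_of_mem (hx i trivial) _).symm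
    · rw [Set.indicator_of_notMem hx]
      simp only [Set.mem_pi, Set.mem_univ, true_implies, not_forall] at hx
      obtain ⟨i, hi⟩ := hx
      exact (Finset.prod_eq_zero (Finset.mem_univ i) (Set.indicator_of_notMem hi _)).symm
  simp_rw [this]
  rw [lintegral_pi_prod_eq μ _ fun i => (hf i).indicator (hs i)]
  refine Finset.prod_congr rfl fun i _ => ?_
  rw [withDensity_apply _ (hs i), lintegral_indicator (hs i)]

theorem map_pi_prod_pi {ι : Type*} [Fintype ι] {α β : ι → Type*} [∀ i, MeasurableSpace (α i)]
    [∀ i, MeasurableSpace (β i)] (μ : ∀ i, Measure (α i)) (ρ : ∀ i, Measure (β i))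
    [∀ i, IsProbabilityMeasure (μ i)] [∀ i, IsProbabilityMeasure (ρ i)] :
    ((Measure.pi μ).prod (Measure.pi ρ)).map (fun p i => (p.1 i, p.2 i)) =
      Measure.pi fun i => (μ i).prod (ρ i) := by
  refine (Measure.pi_eq fun s hs => ?_).symm
  have hm : Measurable fun (p : (∀ i, α i) × (∀ i, β i)) i => (p.1 i, p.2 i) := by fun_prop
  rw [Measure.map_apply hm (MeasurableSet.univ_pi hs),
    Measure.prod_apply (hm (MeasurableSet.univ_pi hs))]
  have : ∀ x : ∀ i, α i, Measure.pi ρ (Prod.mk x ⁻¹' ((fun p i => (p.1 i, p.2 i)) ⁻¹'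
      Set.pi Set.univ s)) = ∏ i, ρ i (Prod.mk (x i) ⁻¹' s i) := by
    intro x
    rw [← Measure.pi_pi]
    congr 1
  simp_rw [this]
  rw [lintegral_pi_prod_eq μ (fun i a => ρ i (Prod.mk a ⁻¹' s i))
    fun i => measurable_measure_prodMk_left (hs i)]
  exact Finset.prod_congr rfl fun i _ => (Measure.prod_apply (hs i)).symm

/-- If every factor is an image of a product measure, the joint law is an image of the product of
the two joint laws. -/
theorem pi_map_prod {ι : Type*} [Fintype ι] {α β γ : ι → Type*} [∀ i, MeasurableSpace (α i)]
    [∀ i, MeasurableSpace (β i)] [∀ i, MeasurableSpace (γ i)] (μ : ∀ i, Measure (α i))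
    (ρ : ∀ i, Measure (β i)) [∀ i, IsProbabilityMeasure (μ i)] [∀ i, IsProbabilityMeasure (ρ i)]
    {f : ∀ i, α i × β i → γ i} (hf : ∀ i, Measurable (f i)) :
    Measure.pi (fun i => ((μ i).prod (ρ i)).map (f i)) =
      ((Measure.pi μ).prod (Measure.pi ρ)).map fun p i => f i (p.1 i, p.2 i) := by
  have hp : ∀ i, IsProbabilityMeasure (((μ i).prod (ρ i)).map (f i)) := fun i =>
    Measure.isProbabilityMeasure_map (hf i).aemeasurable
  rw [← Measure.pi_map_pi fun i => (hf i).aemeasurable, ← map_pi_prod_pi,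
    Measure.map_map (by fun_prop) (by fun_prop)]
  rfl

/-- A kernel that is represented by a randomization `ρ` and a function `f` turns `μ` into the law of
`(a, f a c)` for independent `a` and `c`. -/
theorem compProd_eq_map_prod {α β γ : Type*} [MeasurableSpace α] [MeasurableSpace β]
    [MeasurableSpace γ] (μ : Measure α) [SFinite μ] (k : Kernel α β) [IsSFiniteKernel k]
    (ρ : Measure γ) [SFinite ρ] {f : α → γ → β} (hf : Measurable (Function.uncurry f))
    (hk : ∀ a, ρ.map (f a) = k a) :
    μ ⊗ₘ k = (μ.prod ρ).map fun p => (p.1, f p.1 p.2) := by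
  have hm : Measurable fun p : α × γ => (p.1, f p.1 p.2) := measurable_fst.prodMk hf
  ext s hs
  rw [Measure.compProd_apply hs, Measure.map_apply hm hs, Measure.prod_apply (hm hs)]
  refine lintegral_congr fun a => ?_
  have hfa : Measurable (f a) := hf.comp measurable_prodMk_left
  rw [← hk a, Measure.map_apply hfa (measurable_prodMk_left hs)]
  rfl

theorem withDensity_compProd {α β : Type*} [MeasurableSpace α] [MeasurableSpace β]
    (μ : Measure α) [SFinite μ] (k : Kernel α β) [IsSFiniteKernel k] (f : α → ℝ≥0∞)
    (hf : Measurable f) [SFinite (μ.withDensity f)] :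
    μ.withDensity f ⊗ₘ k = (μ ⊗ₘ k).withDensity fun p => f p.1 := by
  ext s hs
  rw [withDensity_apply _ hs, Measure.compProd_apply hs,
    lintegral_withDensity_eq_lintegral_mul _ hf (Kernel.measurable_kernel_prodMk_left hs),
    ← lintegral_indicator hs,
    Measure.lintegral_compProd (f := s.indicator fun p => f p.1)
      ((hf.comp measurable_fst).indicator hs)]
  refine lintegral_congr fun a => ?_
  have : ∀ b, s.indicator (fun p : α × β => f p.1) (a, b) =
      (Prod.mk a ⁻¹' s).indicator (fun _ => f a) b := fun b => rfl
  simp_rw [this]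
  rw [lintegral_indicator (measurable_prodMk_left hs), setLIntegral_const]
  rfl

/-- Measures on a finite product are tight as soon as all their one-dimensional marginals are. -/
theorem isTightMeasureSet_pi {ι : Type*} [Fintype ι] {α : ι → Type*} [∀ i, MeasurableSpace (α i)]
    [∀ i, TopologicalSpace (α i)] {S : Set (Measure (∀ i, α i))}
    (h : ∀ i, IsTightMeasureSet ((fun μ : Measure (∀ i, α i) => μ.map (Function.eval i)) '' S)) :
    IsTightMeasureSet S := by
  rw [isTightMeasureSet_iff_exists_isCompact_measure_compl_le]
  intro ε hε
  obtain ⟨δ, hδ, hsum⟩ := ENNReal.exists_pos_sum_of_countable' hε.ne' ι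
  have h' := fun i =>
    (isTightMeasureSet_iff_exists_isCompact_measure_compl_le.1 (h i)) (δ i) (hδ i)
  choose K hK hKδ using h'
  refine ⟨Set.pi Set.univ K, isCompact_univ_pi hK, fun μ hμ => ?_⟩
  have hsub : (Set.pi Set.univ K)ᶜ ⊆ ⋃ i, Function.eval i ⁻¹' (K i)ᶜ := by
    intro x hx
    simpa [Set.mem_pi] using hx
  calc μ (Set.pi Set.univ K)ᶜ ≤ μ (⋃ i, Function.eval i ⁻¹' (K i)ᶜ) := measure_mono hsub
    _ ≤ ∑' i, μ (Function.eval i ⁻¹' (K i)ᶜ) := measure_iUnion_le _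
    _ ≤ ∑' i, δ i := ENNReal.tsum_le_tsum fun i =>
        (Measure.le_map_apply (measurable_pi_apply i).aemeasurable _).trans
          (hKδ i _ (Set.mem_image_of_mem _ hμ))
    _ ≤ ε := hsum.le

/-- The integral of an unbounded continuous `f ≥ 0` is the supremum of the weakly continuous
integrals of the truncations `min f n`. -/
theorem lowerSemicontinuous_lintegral_coe {E : Type*} [TopologicalSpace E] [MeasurableSpace E]
    [OpensMeasurableSpace E] {f : E → ℝ≥0} (hf : Continuous f) :
    LowerSemicontinuous fun μ : ProbabilityMeasure E => ∫⁻ x, (f x : ℝ≥0∞) ∂(μ : Measure E) := by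
  let g : ℕ → BoundedContinuousFunction E ℝ≥0 := fun n =>
    BoundedContinuousFunction.mkOfBound ⟨fun x => min (f x) n, by fun_prop⟩ n fun x y => by
      rw [NNReal.dist_eq, abs_sub_le_iff]
      have hx : ((min (f x) n : ℝ≥0) : ℝ) ≤ n := by exact_mod_cast min_le_right _ _
      have hy : ((min (f y) n : ℝ≥0) : ℝ) ≤ n := by exact_mod_cast min_le_right _ _
      constructor
      · exact (sub_le_self _ (NNReal.coe_nonneg _)).trans hx
      · exact (sub_le_self _ (NNReal.coe_nonneg _)).trans hy
  have hsup : ∀ x, (f x : ℝ≥0∞) = ⨆ n, (g n x : ℝ≥0∞) := by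
    intro x
    refine le_antisymm ?_ (iSup_le fun n => ENNReal.coe_le_coe.2 (min_le_left _ _))
    obtain ⟨n, hn⟩ := exists_nat_ge (f x)
    refine le_iSup_of_le n (ENNReal.coe_le_coe.2 ?_)
    exact le_min le_rfl hn
  have hmono : Monotone fun n x => (g n x : ℝ≥0∞) := fun m n hmn x =>
    ENNReal.coe_le_coe.2 (min_le_min_left _ (by exact_mod_cast hmn))
  have : (fun μ : ProbabilityMeasure E => ∫⁻ x, (f x : ℝ≥0∞) ∂(μ : Measure E)) =
      fun μ : ProbabilityMeasure E => ⨆ n, ∫⁻ x, (g n x : ℝ≥0∞) ∂(μ : Measure E) := by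
    ext μ
    simp_rw [hsup]
    exact lintegral_iSup (fun n => (g n).continuous.measurable.coe_nnreal_ennreal) hmono
  rw [this]
  exact lowerSemicontinuous_iSup fun n =>
    (ProbabilityMeasure.continuous_lintegral_boundedContinuousFunction (g n)).lowerSemicontinuous

/-- The local alternative in the class `IC` implies the alternative over compact sets: finitely many
of the neighborhoods cover `K`, and the union of their compact sets serves for `K`. -/
theorem ClassIC.exists_isCompact {A B : Type*} [TopologicalSpace A] [TopologicalSpace B]
    {φ : A × B → ℝ≥0} (h : ClassIC φ) {M : ℝ≥0} (hM : 0 < M) {K : Set A} (hK : IsCompact K) :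
    ∃ L : Set B, IsCompact L ∧ ∀ a ∈ K, ∀ b ∈ Lᶜ, M ≤ φ (a, b) := by
  rcases h with h | h
  · exact h M hM K hK
  · choose O hO ha L hL hM using h M hM
    obtain ⟨s, hs⟩ := hK.elim_finite_subcover O hO fun a _ => Set.mem_iUnion.2 ⟨a, ha a⟩
    refine ⟨⋃ a ∈ s, L a, s.isCompact_biUnion fun a _ => hL a, fun a haK b hb => ?_⟩
    obtain ⟨a₀, ha₀, haO⟩ := Set.mem_iUnion₂.1 (hs haK)
    exact hM a₀ a haO b fun hbL => hb (Set.mem_iUnion₂.2 ⟨a₀, ha₀, hbL⟩)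

theorem exists_pos_le_of_isCompact {A : Type*} [TopologicalSpace A] {d : A → ℝ≥0}
    (hd : Continuous d) (hpos : ∀ a, 0 < d a) {K : Set A} (hK : IsCompact K) :
    ∃ δ : ℝ≥0, 0 < δ ∧ ∀ a ∈ K, δ ≤ d a := by
  rcases K.eq_empty_or_nonempty with rfl | hne
  · exact ⟨1, one_pos, by simp⟩
  · obtain ⟨a, -, ha⟩ := hK.exists_isMinOn hne hd.continuousOn
    exact ⟨d a, hpos a, fun b hb => ha hb⟩

/-! ### Paths and densities -/

/-- The path of length `n + 1` that extends a path of length `n` by one more coordinate. -/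
def extendPath {T : ℕ} {A : Fin T → Type*} {n : ℕ} (hn : n + 1 ≤ T)
    (a : Upto A n (Nat.le_of_succ_le hn)) (b : A ⟨n, hn⟩) : Upto A (n + 1) hn :=
  Fin.snoc (α := fun s : Fin (n + 1) => A (s.castLE hn)) a b

theorem extendPath_last {T : ℕ} {A : Fin T → Type*} {n : ℕ} (hn : n + 1 ≤ T)
    (a : Upto A n (Nat.le_of_succ_le hn)) (b : A ⟨n, hn⟩) : extendPath hn a b (Fin.last n) = b :=
  Fin.snoc_last (α := fun s : Fin (n + 1) => A (s.castLE hn)) _ _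

theorem extendPath_castSucc {T : ℕ} {A : Fin T → Type*} {n : ℕ} (hn : n + 1 ≤ T)
    (a : Upto A n (Nat.le_of_succ_le hn)) (b : A ⟨n, hn⟩) (s : Fin n) :
    extendPath hn a b s.castSucc = a s :=
  Fin.snoc_castSucc (α := fun s : Fin (n + 1) => A (s.castLE hn)) _ _ _

theorem measurable_extendPath {T : ℕ} {A : Fin T → Type*} [∀ s, MeasurableSpace (A s)] {n : ℕ}
    (hn : n + 1 ≤ T) {β : Type*} [MeasurableSpace β]
    {f : β → Upto A n (Nat.le_of_succ_le hn)} {g : β → A ⟨n, hn⟩}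
    (hf : Measurable f) (hg : Measurable g) : Measurable fun b => extendPath hn (f b) (g b) := by
  refine measurable_pi_lambda _ fun s => ?_
  refine Fin.lastCases ?_ (fun s => ?_) s
  · simpa only [extendPath_last] using hg
  · simp only [extendPath_castSucc]
    exact (measurable_pi_apply s).comp hf

theorem map_extendPath_pi {T : ℕ} {A : Fin T → Type*} [∀ s, MeasurableSpace (A s)]
    (μ : ∀ s, Measure (A s)) [∀ s, SigmaFinite (μ s)] {n : ℕ} (hn : n + 1 ≤ T) :
    ((Measure.pi fun s : Fin n => μ (s.castLE (Nat.le_of_succ_le hn))).prod (μ ⟨n, hn⟩)).map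
      (fun p => extendPath hn p.1 p.2) = Measure.pi fun s : Fin (n + 1) => μ (s.castLE hn) := by
  refine (Measure.pi_eq fun s hs => ?_).symm
  rw [Measure.map_apply (measurable_extendPath hn measurable_fst measurable_snd)
    (MeasurableSet.univ_pi hs)]
  have : (fun p : Upto A n (Nat.le_of_succ_le hn) × A ⟨n, hn⟩ => extendPath hn p.1 p.2) ⁻¹'
      Set.pi Set.univ s = (Set.pi Set.univ fun r : Fin n => s r.castSucc) ×ˢ s (Fin.last n) := by
    ext p
    simp [Set.mem_pi, Fin.forall_fin_succ', extendPath_last, extendPath_castSucc]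
  rw [this, Measure.prod_prod, Measure.pi_pi, Fin.prod_univ_castSucc]
  rfl

namespace DynamicTeam

variable {N T : ℕ} {X : Fin (T + 1) → Type*} {U Y : Fin T → Fin N → Type*}
  {W₀ : Fin T → Type*} {W : Fin T → Fin N → Type*}

/-- The observation coordinates of a path of observation-action pairs. -/
def yPart {n : ℕ} {hn : n ≤ T} (z : Upto (fun s => ∀ i, Y s i × U s i) n hn) :
    Upto (fun s => ∀ i, Y s i) n hn := fun s i => (z s i).1

/-- The action coordinates of a path of observation-action pairs. -/
def uPart {n : ℕ} {hn : n ≤ T} (z : Upto (fun s => ∀ i, Y s i × U s i) n hn) :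
    Upto (fun s => ∀ i, U s i) n hn := fun s i => (z s i).2

/-- The joint density of all agents' observations of time `t`, given `ω₀` and the past actions. -/
def stageDens (φ : ∀ (t : Fin T) (i : Fin N),
      Y t i × Omega X W₀ × Upto (fun s => ∀ j, U s j) t t.2.le → ℝ≥0) (t : Fin T)
    (y : ∀ i, Y t i) (ω : Omega X W₀) (u : Upto (fun s => ∀ j, U s j) t t.2.le) : ℝ≥0 :=
  ∏ i, φ t i (y i, ω, u)

/-- The density, with respect to the law under which all observations are independent, of the law of
the first `n` time steps. It is a function of paths of observation-action pairs. -/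
def dens (φ : ∀ (t : Fin T) (i : Fin N),
      Y t i × Omega X W₀ × Upto (fun s => ∀ j, U s j) t t.2.le → ℝ≥0) (n : ℕ) (hn : n ≤ T)
    (ω : Omega X W₀) (z : Upto (fun s => ∀ i, Y s i × U s i) n hn) : ℝ≥0 :=
  ∏ s : Fin n, stageDens φ (s.castLE hn) (fun i => (z s i).1) ω
    fun r j => (z (r.castLE s.2.le) j).2

theorem yPart_extendPath {n : ℕ} {hn : n + 1 ≤ T}
    (z : Upto (fun s => ∀ i, Y s i × U s i) n (Nat.le_of_succ_le hn))
    (z' : ∀ i, Y ⟨n, hn⟩ i × U ⟨n, hn⟩ i) :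
    yPart (extendPath (A := fun s => ∀ i, Y s i × U s i) hn z z') =
      extendPath (A := fun s => ∀ i, Y s i) hn (yPart z) fun i => (z' i).1 := by
  funext s i
  refine Fin.lastCases ?_ (fun s => ?_) s i
  · intro i
    rw [extendPath_last, yPart, extendPath_last]
  · intro i
    rw [extendPath_castSucc, yPart, extendPath_castSucc]
    rfl

theorem uPart_extendPath {n : ℕ} {hn : n + 1 ≤ T}
    (z : Upto (fun s => ∀ i, Y s i × U s i) n (Nat.le_of_succ_le hn))
    (z' : ∀ i, Y ⟨n, hn⟩ i × U ⟨n, hn⟩ i) :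
    uPart (extendPath (A := fun s => ∀ i, Y s i × U s i) hn z z') =
      extendPath (A := fun s => ∀ i, U s i) hn (uPart z) fun i => (z' i).2 := by
  funext s i
  refine Fin.lastCases ?_ (fun s => ?_) s i
  · intro i
    rw [extendPath_last, uPart, extendPath_last]
  · intro i
    rw [extendPath_castSucc, uPart, extendPath_castSucc]
    rfl

theorem dens_extendPath (φ : ∀ (t : Fin T) (i : Fin N),
      Y t i × Omega X W₀ × Upto (fun s => ∀ j, U s j) t t.2.le → ℝ≥0) {n : ℕ} {hn : n + 1 ≤ T}
    (ω : Omega X W₀)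
    (z : Upto (fun s => ∀ i, Y s i × U s i) n (Nat.le_of_succ_le hn))
    (z' : ∀ i, Y ⟨n, hn⟩ i × U ⟨n, hn⟩ i) :
    dens φ (n + 1) hn ω (extendPath (A := fun s => ∀ i, Y s i × U s i) hn z z') =
      dens φ n (Nat.le_of_succ_le hn) ω z *
        stageDens φ ⟨n, hn⟩ (fun i => (z' i).1) ω (uPart z) := by
  have key := extendPath_castSucc (A := fun s => ∀ i, Y s i × U s i) hn z z'
  rw [dens, Fin.prod_univ_castSucc, extendPath_last]
  refine congrArg₂ (· * ·) (Finset.prod_congr rfl fun s _ => ?_) ?_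
  · rw [key s]
    refine congrArg (stageDens φ (s.castLE (Nat.le_of_succ_le hn)) (fun i => (z s i).1) ω) ?_
    funext r j
    exact congrArg (fun x => (x j).2) (key (r.castLE s.2.le))
  · refine congrArg (stageDens φ ⟨n, hn⟩ (fun i => (z' i).1) ω) ?_
    funext r j
    exact congrArg (fun x => (x j).2) (key r)

theorem dens_pos {φ : ∀ (t : Fin T) (i : Fin N),
      Y t i × Omega X W₀ × Upto (fun s => ∀ j, U s j) t t.2.le → ℝ≥0}
    (hφ : ∀ t i p, 0 < φ t i p) (n : ℕ) (hn : n ≤ T) (ω : Omega X W₀)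
    (z : Upto (fun s => ∀ i, Y s i × U s i) n hn) : 0 < dens φ n hn ω z :=
  Finset.prod_pos fun _ _ => Finset.prod_pos fun _ _ => hφ _ _ _

section Continuity

variable [∀ s, TopologicalSpace (X s)] [∀ t i, TopologicalSpace (U t i)]
    [∀ t i, TopologicalSpace (Y t i)] [∀ t, TopologicalSpace (W₀ t)]

theorem continuous_yPart {n : ℕ} {hn : n ≤ T} :
    Continuous (yPart (Y := Y) (U := U) (n := n) (hn := hn)) := by
  unfold yPart; fun_prop

theorem continuous_uPart {n : ℕ} {hn : n ≤ T} :
    Continuous (uPart (Y := Y) (U := U) (n := n) (hn := hn)) := by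
  unfold uPart; fun_prop

theorem continuous_stageDens {φ : ∀ (t : Fin T) (i : Fin N),
      Y t i × Omega X W₀ × Upto (fun s => ∀ j, U s j) t t.2.le → ℝ≥0}
    (hφ : ∀ t i, Continuous (φ t i)) (t : Fin T) :
    Continuous fun p : (∀ i, Y t i) × Omega X W₀ × Upto (fun s => ∀ j, U s j) t t.2.le =>
      stageDens φ t p.1 p.2.1 p.2.2 :=
  continuous_finsetProd _ fun i _ => (hφ t i).comp (by fun_prop)

theorem continuous_dens {φ : ∀ (t : Fin T) (i : Fin N),
      Y t i × Omega X W₀ × Upto (fun s => ∀ j, U s j) t t.2.le → ℝ≥0}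
    (hφ : ∀ t i, Continuous (φ t i)) (n : ℕ) (hn : n ≤ T) :
    Continuous fun p : Omega X W₀ × Upto (fun s => ∀ i, Y s i × U s i) n hn =>
      dens φ n hn p.1 p.2 := by
  refine continuous_finsetProd _ fun s _ => ?_
  refine (continuous_stageDens hφ (s.castLE hn)).comp
    (f := fun p : Omega X W₀ × Upto (fun s => ∀ i, Y s i × U s i) n hn =>
      ((fun i => (p.2 s i).1, p.1, fun r j => (p.2 (r.castLE s.2.le) j).2) :
        (∀ i, Y (s.castLE hn) i) × Omega X W₀ ×
          Upto (fun s => ∀ j, U s j) (s.castLE hn) (s.castLE hn).2.le)) ?_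
  refine Continuous.prodMk (by fun_prop) (Continuous.prodMk (by fun_prop) ?_)
  refine continuous_pi fun r => continuous_pi fun j => ?_
  exact continuous_snd.comp ((continuous_apply j).comp
    ((continuous_apply (r.castLE s.2.le : Fin n)).comp continuous_snd))

end Continuity

/-! ### Static reduction -/

/-- A history of length `n`: the value of `ω₀` and the observations and actions of the first `n`
time steps. -/
abbrev History (X : Fin (T + 1) → Type*) (W₀ : Fin T → Type*) (Y U : Fin T → Fin N → Type*)
    (n : ℕ) (hn : n ≤ T) :=
  Omega X W₀ × Upto (fun s => ∀ i, Y s i) n hn × Upto (fun s => ∀ i, U s i) n hn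

/-- The history extended by the observation-action pairs of one more stage. -/
def extendHistory {n : ℕ} (hn : n + 1 ≤ T) (p : History X W₀ Y U n (Nat.le_of_succ_le hn))
    (z : ∀ i, Y ⟨n, hn⟩ i × U ⟨n, hn⟩ i) : History X W₀ Y U (n + 1) hn :=
  (p.1, extendPath (A := fun s => ∀ i, Y s i) hn p.2.1 fun i => (z i).1,
    extendPath (A := fun s => ∀ i, U s i) hn p.2.2 fun i => (z i).2)

/-- The history that consists of `ω₀` and a path of observation-action pairs. -/
def toHistory {n : ℕ} {hn : n ≤ T}
    (q : Omega X W₀ × Upto (fun s => ∀ i, Y s i × U s i) n hn) : History X W₀ Y U n hn :=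
  (q.1, yPart q.2, uPart q.2)

theorem toHistory_extendPath {n : ℕ} {hn : n + 1 ≤ T} (ω : Omega X W₀)
    (z : Upto (fun s => ∀ i, Y s i × U s i) n (Nat.le_of_succ_le hn))
    (z' : ∀ i, Y ⟨n, hn⟩ i × U ⟨n, hn⟩ i) :
    toHistory (X := X) (W₀ := W₀)
      (ω, extendPath (A := fun s => ∀ i, Y s i × U s i) hn z z') =
      extendHistory hn (toHistory (ω, z)) z' := by
  simp only [toHistory, yPart_extendPath, uPart_extendPath]
  rfl

instance Strategy.isMarkovKernel [∀ t i, MeasurableSpace (U t i)] [∀ t i, MeasurableSpace (Y t i)]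
    (π : Strategy Y U) (t : Fin T) (i : Fin N) : IsMarkovKernel (π t i).1 := (π t i).2

section Laws

variable [MeasurableSpace (X 0)] [∀ t, MeasurableSpace (W₀ t)] [∀ t i, MeasurableSpace (W t i)]
  [∀ t i, MeasurableSpace (U t i)] [∀ t i, MeasurableSpace (Y t i)]

instance (D : DynamicTeam N T X U Y W₀ W) : IsProbabilityMeasure D.omegaLaw := by
  unfold omegaLaw; infer_instance

/-- The law of the observation-action pair of agent `i` at time `t`, when the observation has
law `ν t i`. -/
noncomputable def pairLaw (ν : ∀ t i, ProbabilityMeasure (Y t i)) (π : Strategy Y U) (t : Fin T)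
    (i : Fin N) : Measure (Y t i × U t i) :=
  (ν t i : Measure (Y t i)) ⊗ₘ (π t i).1

instance (ν : ∀ t i, ProbabilityMeasure (Y t i)) (π : Strategy Y U) (t : Fin T)
    (i : Fin N) : IsProbabilityMeasure (pairLaw ν π t i) := by
  unfold pairLaw; infer_instance

/-- The law under which `ω₀` and all observation-action pairs of the first `n` time steps are
independent, the pair of agent `i` at time `t` having law `μ t i`. -/
noncomputable def refLaw (D : DynamicTeam N T X U Y W₀ W) (μ : ∀ t i, Measure (Y t i × U t i))
    (n : ℕ) (hn : n ≤ T) : Measure (Omega X W₀ × Upto (fun s => ∀ i, Y s i × U s i) n hn) :=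
  D.omegaLaw.prod (Measure.pi fun s : Fin n => Measure.pi (μ (s.castLE hn)))

instance (D : DynamicTeam N T X U Y W₀ W) (μ : ∀ t i, Measure (Y t i × U t i))
    [∀ t i, IsProbabilityMeasure (μ t i)] (n : ℕ) (hn : n ≤ T) :
    IsProbabilityMeasure (D.refLaw μ n hn) := by
  unfold refLaw; infer_instance

theorem refLaw_succ (D : DynamicTeam N T X U Y W₀ W) (μ : ∀ t i, Measure (Y t i × U t i))
    [∀ t i, IsProbabilityMeasure (μ t i)] (n : ℕ) (hn : n + 1 ≤ T) :
    D.refLaw μ (n + 1) hn =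
      ((D.refLaw μ n (Nat.le_of_succ_le hn)).prod (Measure.pi (μ ⟨n, hn⟩))).map
        fun p => (p.1.1, extendPath (A := fun s => ∀ i, Y s i × U s i) hn p.1.2 p.2) := by
  have hm : Measurable fun p : Upto (fun s => ∀ i, Y s i × U s i) n (Nat.le_of_succ_le hn) ×
      (∀ i, Y ⟨n, hn⟩ i × U ⟨n, hn⟩ i) =>
        extendPath (A := fun s => ∀ i, Y s i × U s i) hn p.1 p.2 :=
    measurable_extendPath hn measurable_fst measurable_snd
  rw [refLaw, refLaw, ← map_extendPath_pi (A := fun s => ∀ i, Y s i × U s i)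
    (fun s => Measure.pi (μ s)) hn]
  conv_lhs => rw [← Measure.map_id (μ := D.omegaLaw)]
  rw [Measure.map_prod_map _ _ measurable_id hm,
    ← (measurePreserving_prodAssoc D.omegaLaw _ _).map_eq,
    Measure.map_map (measurable_id.prodMap hm) (by fun_prop)]
  rfl

end Laws

section Reduction

set_option linter.unusedSectionVars false

variable [∀ s, TopologicalSpace (X s)] [∀ s, PolishSpace (X s)]
    [∀ s, MeasurableSpace (X s)] [∀ s, BorelSpace (X s)]
    [∀ t i, TopologicalSpace (U t i)] [∀ t i, PolishSpace (U t i)]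
    [∀ t i, MeasurableSpace (U t i)] [∀ t i, BorelSpace (U t i)]
    [∀ t i, TopologicalSpace (Y t i)] [∀ t i, PolishSpace (Y t i)]
    [∀ t i, MeasurableSpace (Y t i)] [∀ t i, BorelSpace (Y t i)]
    [∀ t, TopologicalSpace (W₀ t)] [∀ t, PolishSpace (W₀ t)]
    [∀ t, MeasurableSpace (W₀ t)] [∀ t, BorelSpace (W₀ t)]
    [∀ t i, MeasurableSpace (W t i)]

/-- The observation kernels have continuous, strictly positive densities `φ` with respect to the
fixed laws `ν`. The field `prob` records that they are probability kernels, as they are whenever the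
observation functions are measurable in the noise. -/
structure HasObsDensity (D : DynamicTeam N T X U Y W₀ W)
    (ν : ∀ t i, ProbabilityMeasure (Y t i))
    (φ : ∀ (t : Fin T) (i : Fin N),
      Y t i × Omega X W₀ × Upto (fun s => ∀ j, U s j) t t.2.le → ℝ≥0) : Prop where
  cont : ∀ t i, Continuous (φ t i)
  pos : ∀ t i p, 0 < φ t i p
  prob : ∀ t i ω u, IsProbabilityMeasure (D.obsLaw t i ω u)
  obsLaw_apply : ∀ (t : Fin T) (i : Fin N) (ω : Omega X W₀)
      (u : Upto (fun s => ∀ j, U s j) t t.2.le) (S : Set (Y t i)), MeasurableSet S →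
      D.obsLaw t i ω u S = ∫⁻ y in S, (φ t i (y, ω, u) : ℝ≥0∞) ∂(ν t i : Measure (Y t i))

variable {D : DynamicTeam N T X U Y W₀ W} {ν : ∀ t i, ProbabilityMeasure (Y t i)}
    {φ : ∀ (t : Fin T) (i : Fin N),
      Y t i × Omega X W₀ × Upto (fun s => ∀ j, U s j) t t.2.le → ℝ≥0}

theorem HasObsDensity.stageLaw_eq (h : D.HasObsDensity ν φ) (π : Strategy Y U) (t : Fin T)
    (ω : Omega X W₀) (u : Upto (fun s => ∀ j, U s j) t t.2.le) :
    D.stageLaw π t ω u = (Measure.pi (pairLaw ν π t)).withDensity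
      fun z => (stageDens φ t (fun i => (z i).1) ω u : ℝ≥0∞) := by
  have hm : ∀ i, Measurable fun y => (φ t i (y, ω, u) : ℝ≥0∞) := fun i =>
    ((h.cont t i).comp (by fun_prop)).measurable.coe_nnreal_ennreal
  have hobs : ∀ i, D.obsLaw t i ω u =
      (ν t i : Measure (Y t i)).withDensity fun y => (φ t i (y, ω, u) : ℝ≥0∞) := fun i =>
    Measure.ext fun S hS => by rw [h.obsLaw_apply t i ω u S hS, withDensity_apply _ hS]
  have hpair : ∀ i, D.obsLaw t i ω u ⊗ₘ (π t i).1 =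
      (pairLaw ν π t i).withDensity fun p => (φ t i (p.1, ω, u) : ℝ≥0∞) := fun i => by
    have := h.prob t i ω u
    rw [hobs] at this ⊢
    exact withDensity_compProd _ _ _ (hm i)
  have hprob : ∀ i, IsProbabilityMeasure
      ((pairLaw ν π t i).withDensity fun p => (φ t i (p.1, ω, u) : ℝ≥0∞)) := fun i => by
    have := h.prob t i ω u
    rw [← hpair]
    infer_instance
  simp_rw [stageLaw, hpair]
  refine (pi_withDensity_eq (pairLaw ν π t) (fun i p => (φ t i (p.1, ω, u) : ℝ≥0∞))
    fun i => (hm i).comp measurable_fst).trans ?_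
  simp only [stageDens, ENNReal.ofNNReal_finsetProd]

theorem HasObsDensity.isProbabilityMeasure_stageLaw (h : D.HasObsDensity ν φ) (π : Strategy Y U)
    (t : Fin T) (ω : Omega X W₀) (u : Upto (fun s => ∀ j, U s j) t t.2.le) :
    IsProbabilityMeasure (D.stageLaw π t ω u) := by
  have := fun i => h.prob t i ω u
  unfold stageLaw
  infer_instance

theorem HasObsDensity.measurable_stageDens (h : D.HasObsDensity ν φ) (t : Fin T)
    {β : Type*} [MeasurableSpace β] {f : β → ∀ i, Y t i} {g : β → Omega X W₀}
    {k : β → Upto (fun s => ∀ j, U s j) t t.2.le} (hf : Measurable f) (hg : Measurable g)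
    (hk : Measurable k) : Measurable fun b => (stageDens φ t (f b) (g b) (k b) : ℝ≥0∞) :=
  (continuous_stageDens h.cont t).measurable.coe_nnreal_ennreal.comp (hf.prodMk (hg.prodMk hk))

theorem measurable_extendHistory (n : ℕ) (hn : n + 1 ≤ T) :
    Measurable fun q : History X W₀ Y U n (Nat.le_of_succ_le hn) ×
      (∀ i, Y ⟨n, hn⟩ i × U ⟨n, hn⟩ i) => extendHistory hn q.1 q.2 :=
  Measurable.prodMk (by fun_prop) (Measurable.prodMk
    (measurable_extendPath hn (by fun_prop) (by fun_prop))
    (measurable_extendPath hn (by fun_prop) (by fun_prop)))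

theorem HasObsDensity.lintegral_stageLaw (h : D.HasObsDensity ν φ) (π : Strategy Y U) (t : Fin T)
    (ω : Omega X W₀) (u : Upto (fun s => ∀ j, U s j) t t.2.le)
    {F : (∀ i, Y t i × U t i) → ℝ≥0∞} (hF : Measurable F) :
    ∫⁻ z, F z ∂(D.stageLaw π t ω u) =
      ∫⁻ z, F z * (stageDens φ t (fun i => (z i).1) ω u : ℝ≥0∞) ∂(Measure.pi (pairLaw ν π t)) := by
  rw [h.stageLaw_eq, lintegral_withDensity_eq_lintegral_mul _ (h.measurable_stageDens t
    (by fun_prop) (by fun_prop) (by fun_prop)) hF]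
  exact lintegral_congr fun z => mul_comm _ _

/-- Integration against the law of `n + 1` time steps: first the last stage, then the past. This is
the definition of `jointLaw`, once the law of a stage is known to depend measurably on the past; the
density supplies the measurability, by Tonelli's theorem. -/
theorem HasObsDensity.lintegral_jointLaw_succ (h : D.HasObsDensity ν φ) (π : Strategy Y U)
    (n : ℕ) (hn : n + 1 ≤ T) {F : History X W₀ Y U (n + 1) hn → ℝ≥0∞} (hF : Measurable F) :
    ∫⁻ p, F p ∂(D.jointLaw π (n + 1) hn) =
      ∫⁻ p, ∫⁻ z, F (extendHistory hn p z) ∂(D.stageLaw π ⟨n, hn⟩ p.1 p.2.2)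
        ∂(D.jointLaw π n (Nat.le_of_succ_le hn)) := by
  have hext : ∀ p : History X W₀ Y U n (Nat.le_of_succ_le hn),
      Measurable fun z => extendHistory hn p z := fun p =>
    (measurable_extendHistory n hn).comp (measurable_prodMk_left (x := p))
  have hker : Measurable fun p : History X W₀ Y U n (Nat.le_of_succ_le hn) =>
      (D.stageLaw π ⟨n, hn⟩ p.1 p.2.2).map fun z => extendHistory hn p z := by
    refine Measure.measurable_of_measurable_coe _ fun S hS => ?_
    have hrw : ∀ p : History X W₀ Y U n (Nat.le_of_succ_le hn),
        ((D.stageLaw π ⟨n, hn⟩ p.1 p.2.2).map fun z => extendHistory hn p z) S =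
        ∫⁻ z, S.indicator 1 (extendHistory hn p z) *
          (stageDens φ ⟨n, hn⟩ (fun i => (z i).1) p.1 p.2.2 : ℝ≥0∞)
          ∂(Measure.pi (pairLaw ν π ⟨n, hn⟩)) := by
      intro p
      rw [← lintegral_indicator_one hS, lintegral_map (measurable_one.indicator hS) (hext p)]
      exact h.lintegral_stageLaw π _ _ _ ((measurable_one.indicator hS).comp (hext p))
    simp_rw [hrw]
    refine Measurable.lintegral_prod_right'
      (f := fun q : History X W₀ Y U n (Nat.le_of_succ_le hn) ×
        (∀ i, Y ⟨n, hn⟩ i × U ⟨n, hn⟩ i) => S.indicator 1 (extendHistory hn q.1 q.2) *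
          (stageDens φ ⟨n, hn⟩ (fun i => (q.2 i).1) q.1.1 q.1.2.2 : ℝ≥0∞)) ?_
    exact ((measurable_one.indicator hS).comp (measurable_extendHistory n hn)).mul
      (h.measurable_stageDens ⟨n, hn⟩ (by fun_prop) (by fun_prop) (by fun_prop))
  change ∫⁻ p, F p ∂((D.jointLaw π n (Nat.le_of_succ_le hn)).bind _) = _
  refine (Measure.lintegral_bind hker.aemeasurable hF.aemeasurable).trans ?_
  exact lintegral_congr fun p => lintegral_map hF (hext p)

theorem measurable_toHistory {n : ℕ} {hn : n ≤ T} :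
    Measurable (toHistory (X := X) (W₀ := W₀) (Y := Y) (U := U) (n := n) (hn := hn)) :=
  (continuous_fst.prodMk ((continuous_yPart.comp continuous_snd).prodMk
    (continuous_uPart.comp continuous_snd))).measurable

theorem HasObsDensity.measurable_dens (h : D.HasObsDensity ν φ) (n : ℕ) (hn : n ≤ T) :
    Measurable fun q : Omega X W₀ × Upto (fun s => ∀ i, Y s i × U s i) n hn =>
      (dens φ n hn q.1 q.2 : ℝ≥0∞) :=
  (continuous_dens h.cont n hn).measurable.coe_nnreal_ennreal

/-- The static reduction: the law of a history has the density `dens` with respect to the law under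
which `ω₀` and all observation-action pairs are independent. -/
theorem HasObsDensity.lintegral_jointLaw (h : D.HasObsDensity ν φ) (π : Strategy Y U) :
    ∀ (n : ℕ) (hn : n ≤ T) {F : History X W₀ Y U n hn → ℝ≥0∞}, Measurable F →
      ∫⁻ p, F p ∂(D.jointLaw π n hn) =
        ∫⁻ q, F (toHistory q) * (dens φ n hn q.1 q.2 : ℝ≥0∞) ∂(D.refLaw (pairLaw ν π) n hn)
  | 0, hn, F, hF => by
    rw [jointLaw, lintegral_map hF (by fun_prop), refLaw, Measure.pi_of_empty, Measure.prod_dirac,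
      lintegral_map]
    · refine lintegral_congr fun ω => ?_
      simp only [dens, Finset.univ_eq_empty, Finset.prod_empty, ENNReal.coe_one, mul_one]
      refine congrArg F (congrArg (Prod.mk ω) ?_)
      exact Prod.ext (Subsingleton.elim _ _) (Subsingleton.elim _ _)
    · exact (hF.comp measurable_toHistory).mul (h.measurable_dens 0 hn)
    · fun_prop
  | n + 1, hn, F, hF => by
    have hF' : Measurable fun q : History X W₀ Y U n (Nat.le_of_succ_le hn) ×
        (∀ i, Y ⟨n, hn⟩ i × U ⟨n, hn⟩ i) => F (extendHistory hn q.1 q.2) *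
          (stageDens φ ⟨n, hn⟩ (fun i => (q.2 i).1) q.1.1 q.1.2.2 : ℝ≥0∞) :=
      (hF.comp (measurable_extendHistory n hn)).mul
        (h.measurable_stageDens ⟨n, hn⟩ (by fun_prop) (by fun_prop) (by fun_prop))
    have hap : Measurable fun p : (Omega X W₀ ×
        Upto (fun s => ∀ i, Y s i × U s i) n (Nat.le_of_succ_le hn)) ×
        (∀ i, Y ⟨n, hn⟩ i × U ⟨n, hn⟩ i) =>
        (p.1.1, extendPath (A := fun s => ∀ i, Y s i × U s i) hn p.1.2 p.2) :=
      Measurable.prodMk (by fun_prop) (measurable_extendPath hn (by fun_prop) (by fun_prop))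
    have hG : Measurable fun q : Omega X W₀ × Upto (fun s => ∀ i, Y s i × U s i) (n + 1) hn =>
        F (toHistory q) * (dens φ (n + 1) hn q.1 q.2 : ℝ≥0∞) :=
      (hF.comp measurable_toHistory).mul (h.measurable_dens (n + 1) hn)
    rw [h.lintegral_jointLaw_succ π n hn hF]
    have hstage : ∀ p : History X W₀ Y U n (Nat.le_of_succ_le hn),
        ∫⁻ z, F (extendHistory hn p z) ∂(D.stageLaw π ⟨n, hn⟩ p.1 p.2.2) =
        ∫⁻ z, F (extendHistory hn p z) *
          (stageDens φ ⟨n, hn⟩ (fun i => (z i).1) p.1 p.2.2 : ℝ≥0∞)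
          ∂(Measure.pi (pairLaw ν π ⟨n, hn⟩)) := fun p =>
      h.lintegral_stageLaw π _ _ _ (hF.comp ((measurable_extendHistory n hn).comp
        (measurable_prodMk_left (x := p))))
    simp_rw [hstage]
    rw [HasObsDensity.lintegral_jointLaw h π n (Nat.le_of_succ_le hn) hF'.lintegral_prod_right',
      refLaw_succ, lintegral_map hG hap]
    refine Eq.trans ?_ (lintegral_prod _ (hG.comp hap).aemeasurable).symm
    refine lintegral_congr fun q => ?_
    refine (lintegral_mul_const _
      (hF'.comp (measurable_prodMk_left (x := toHistory q)))).symm.trans ?_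
    refine lintegral_congr fun z => ?_
    simp only [Function.comp_apply, toHistory_extendPath, dens_extendPath, ENNReal.coe_mul]
    rw [mul_assoc, mul_comm (dens φ n _ _ _ : ℝ≥0∞)]
    rfl

/-! ### Tightness of the laws of the pairs -/

/-- The first `n` time steps of a history of length `m`. -/
def restrictHistory {n m : ℕ} (hnm : n ≤ m) {hm : m ≤ T} (p : History X W₀ Y U m hm) :
    History X W₀ Y U n (hnm.trans hm) :=
  (p.1, fun s => p.2.1 (s.castLE hnm), fun s => p.2.2 (s.castLE hnm))

theorem measurable_restrictHistory {n m : ℕ} (hnm : n ≤ m) {hm : m ≤ T} :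
    Measurable (restrictHistory (X := X) (W₀ := W₀) (Y := Y) (U := U) hnm (hm := hm)) :=
  Measurable.prodMk (by fun_prop) (Measurable.prodMk
    (measurable_pi_lambda _ fun s => (measurable_pi_apply _).comp (by fun_prop))
    (measurable_pi_lambda _ fun s => (measurable_pi_apply _).comp (by fun_prop)))

/-- The law of the first `n` of `m` time steps is `jointLaw π n`: later stages integrate to `1`. -/
theorem HasObsDensity.lintegral_restrictHistory (h : D.HasObsDensity ν φ) (π : Strategy Y U)
    {n m : ℕ} (hnm : n ≤ m) (hm : m ≤ T) {F : History X W₀ Y U n (hnm.trans hm) → ℝ≥0∞}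
    (hF : Measurable F) :
    ∫⁻ p, F (restrictHistory hnm p) ∂(D.jointLaw π m hm) =
      ∫⁻ p, F p ∂(D.jointLaw π n (hnm.trans hm)) := by
  induction m, hnm using Nat.le_induction with
  | base => rfl
  | succ m hnm ih =>
    refine (h.lintegral_jointLaw_succ π m hm (hF.comp (measurable_restrictHistory _))).trans ?_
    rw [← ih (Nat.le_of_succ_le hm) hF]
    refine lintegral_congr fun p => ?_
    have := h.isProbabilityMeasure_stageLaw π ⟨m, hm⟩ p.1 p.2.2
    have hrestr : ∀ z, restrictHistory (hnm.trans (Nat.le_succ m)) (extendHistory hm p z) =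
        restrictHistory hnm p := by
      intro z
      refine congrArg (Prod.mk p.1) (Prod.ext (funext fun s => ?_) (funext fun s => ?_))
      · exact extendPath_castSucc (A := fun s => ∀ i, Y s i) hm _ _ (s.castLE hnm)
      · exact extendPath_castSucc (A := fun s => ∀ i, U s i) hm _ _ (s.castLE hnm)
    simp only [Function.comp_apply, hrestr, lintegral_const, measure_univ, mul_one]

theorem isTightMeasureSet_refLaw (D : DynamicTeam N T X U Y W₀ W) (S : Set (Strategy Y U)) (n : ℕ)
    (hn : n ≤ T)
    (h : ∀ (s : Fin n) i, IsTightMeasureSet ((fun π => pairLaw ν π (s.castLE hn) i) '' S)) :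
    IsTightMeasureSet ((fun π => D.refLaw (pairLaw ν π) n hn) '' S) := by
  refine IsTightMeasureSet.prodMk ?_ ?_
  · refine (isTightMeasureSet_singleton (μ := D.omegaLaw)).subset ?_
    rintro _ ⟨_, ⟨π, -, rfl⟩, rfl⟩
    simp [refLaw]
  · refine isTightMeasureSet_pi fun s => isTightMeasureSet_pi fun i => (h s i).subset ?_
    rintro _ ⟨_, ⟨_, ⟨_, ⟨π, hπ, rfl⟩, rfl⟩, rfl⟩, rfl⟩
    refine ⟨π, hπ, ?_⟩
    simp only [refLaw, Measure.snd_prod]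
    rw [(measurePreserving_eval (fun s : Fin n =>
        Measure.pi (pairLaw ν π (s.castLE hn))) s).map_eq,
      (measurePreserving_eval (pairLaw ν π (s.castLE hn)) i).map_eq]

/-- If all coercive terms have expectations bounded by `B` over a set of profiles, then the laws of
the pairs `(y t i, u t i)`, in the static team, are tight over that set. By induction on `t`, the
laws of `ω₀`, the past pairs and the current observations are tight. On a compact set carrying most
of their mass the density is bounded below, so the bound `B` on the cost limits the mass that the
action can have outside a compact set off which `c t i` is large. -/
theorem HasObsDensity.isTightMeasureSet_pairLaw (h : D.HasObsDensity ν φ)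
    {c : ∀ (t : Fin T) (i : Fin N),
      (Omega X W₀ × Upto (fun s => ∀ j, U s j) t t.2.le ×
        Upto (fun s => ∀ j, Y s j) t t.2.le × Y t i) × U t i → ℝ≥0}
    (hccont : ∀ t i, Continuous (c t i)) (hcIC : ∀ t i, ClassIC (c t i))
    {S : Set (Strategy Y U)} {B : ℝ≥0}
    (hS : ∀ π ∈ S, ∀ t i, ∫⁻ p, (c t i ((p.1, truncate p.2.2 t t.2.le, truncate p.2.1 t t.2.le,
      p.2.1 t i), p.2.2 t i) : ℝ≥0∞) ∂(D.jointLaw π T le_rfl) ≤ B) (t : Fin T) (i : Fin N) :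
    IsTightMeasureSet ((fun π => pairLaw ν π t i) '' S) := by
  obtain ⟨n, hn⟩ := t
  induction n using Nat.strong_induction_on generalizing i with
  | _ n ih =>
  have hn' : n + 1 ≤ T := hn
  have hfst : ∀ π : Strategy Y U, ∀ j, (pairLaw ν π ⟨n, hn⟩ j).map Prod.fst =
      (ν ⟨n, hn⟩ j : Measure (Y ⟨n, hn⟩ j)) := fun π j =>
    Measure.fst_compProd _ _
  let t : Fin T := ⟨n, hn⟩
  -- `A` holds `ω₀`, the past pairs and the current observations; `R π` is its law in the static
  -- team, `d` the density of the first `n + 1` stages, and `e` forms the first argument of `c t i`.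
  let A := (Omega X W₀ × Upto (fun s => ∀ i, Y s i × U s i) n hn.le) × ∀ j, Y t j
  let R : Strategy Y U → Measure A := fun π => (D.refLaw (pairLaw ν π) n hn.le).prod
    (Measure.pi fun j => (ν t j : Measure (Y t j)))
  have hR : IsTightMeasureSet (R '' S) := by
    refine IsTightMeasureSet.prodMk ?_ ?_
    · refine (isTightMeasureSet_refLaw D S n hn.le (ν := ν)
        fun s j => ih s s.2 j (s.2.trans hn)).subset ?_
      rintro _ ⟨_, ⟨π, hπ, rfl⟩, rfl⟩
      exact ⟨π, hπ, by simp [R]⟩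
    · refine (isTightMeasureSet_singleton
        (μ := Measure.pi fun j => (ν t j : Measure (Y t j)))).subset ?_
      rintro _ ⟨_, ⟨π, -, rfl⟩, rfl⟩
      simp [R]
  let d : A → ℝ≥0 := fun a => dens φ n hn.le a.1.1 a.1.2 * stageDens φ t a.2 a.1.1 (uPart a.1.2)
  have hd : Continuous d := ((continuous_dens h.cont n hn.le).comp continuous_fst).mul
    ((continuous_stageDens h.cont t).comp (continuous_snd.prodMk
      ((continuous_fst.comp continuous_fst).prodMk
        (continuous_uPart.comp (continuous_snd.comp continuous_fst)))))
  have hdpos : ∀ a, 0 < d a := fun a =>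
    mul_pos (dens_pos h.pos _ _ _ _) (Finset.prod_pos fun _ _ => h.pos _ _ _)
  let e : A → Omega X W₀ × Upto (fun s => ∀ j, U s j) t t.2.le ×
      Upto (fun s => ∀ j, Y s j) t t.2.le × Y t i :=
    fun a => (a.1.1, uPart a.1.2, yPart a.1.2, a.2 i)
  have he : Continuous e := (continuous_fst.comp continuous_fst).prodMk
    ((continuous_uPart.comp (continuous_snd.comp continuous_fst)).prodMk
      ((continuous_yPart.comp (continuous_snd.comp continuous_fst)).prodMk
        ((continuous_apply i).comp continuous_snd)))
  -- `P π` also contains the current actions, which `r` forgets.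
  let r : (Omega X W₀ × Upto (fun s => ∀ i, Y s i × U s i) n hn.le) × (∀ j, Y t j × U t j) → A :=
    fun q => (q.1, fun j => (q.2 j).1)
  have hr : Measurable r := by fun_prop
  let P : Strategy Y U → Measure ((Omega X W₀ × Upto (fun s => ∀ i, Y s i × U s i) n hn.le) ×
      (∀ j, Y t j × U t j)) := fun π =>
    (D.refLaw (pairLaw ν π) n hn.le).prod (Measure.pi (pairLaw ν π t))
  have hPR : ∀ π, (P π).map r = R π := by
    intro π
    have h2 : (Measure.pi (pairLaw ν π t)).map (fun z j => (z j).1) =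
        Measure.pi fun j => (ν t j : Measure (Y t j)) := by
      have hp : ∀ j, IsProbabilityMeasure ((pairLaw ν π t j).map Prod.fst) := fun j =>
        Measure.isProbabilityMeasure_map measurable_fst.aemeasurable
      rw [Measure.pi_map_pi (f := fun j => Prod.fst) fun j => measurable_fst.aemeasurable]
      exact congrArg _ (funext fun j => hfst π j)
    simp only [R]
    rw [← h2]
    conv_rhs => rw [← Measure.map_id (μ := D.refLaw (pairLaw ν π) n hn.le)]
    rw [Measure.map_prod_map _ _ measurable_id (by fun_prop)]
    rfl
  let f : (Omega X W₀ × Upto (fun s => ∀ i, Y s i × U s i) n hn.le) × (∀ j, Y t j × U t j) →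
      ℝ≥0∞ := fun q => (c t i (e (r q), (q.2 i).2) : ℝ≥0∞) * (d (r q) : ℝ≥0∞)
  have hf : Measurable f := by
    refine ((hccont t i).measurable.comp ((he.measurable.comp hr).prodMk
      (by fun_prop))).coe_nnreal_ennreal.mul
      (hd.measurable.comp hr).coe_nnreal_ennreal
  -- Under the true law, the cost term of time `t` only involves the first `n + 1` stages, so that
  -- the later observation densities integrate out.
  have hcost : ∀ π ∈ S, ∫⁻ q, f q ∂(P π) ≤ B := by
    intro π hπ
    let F : History X W₀ Y U (n + 1) hn' → ℝ≥0∞ := fun p =>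
      (c t i ((p.1, fun s => p.2.2 s.castSucc, fun s => p.2.1 s.castSucc,
        p.2.1 (Fin.last n) i), p.2.2 (Fin.last n) i) : ℝ≥0∞)
    have hF : Measurable F := by
      refine ((hccont t i).measurable.comp (Measurable.prodMk (Measurable.prodMk (by fun_prop)
        (Measurable.prodMk ?_ (Measurable.prodMk ?_ ?_))) ?_)).coe_nnreal_ennreal
      · exact measurable_pi_lambda _ fun s => (measurable_pi_apply _).comp (by fun_prop)
      · exact measurable_pi_lambda _ fun s => (measurable_pi_apply _).comp (by fun_prop)
      · exact (measurable_pi_apply i).comp ((measurable_pi_apply (Fin.last n)).comp (by fun_prop))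
      · exact (measurable_pi_apply i).comp ((measurable_pi_apply (Fin.last n)).comp (by fun_prop))
    have hap : Measurable fun p : (Omega X W₀ ×
        Upto (fun s => ∀ i, Y s i × U s i) n hn.le) × (∀ i, Y t i × U t i) =>
        (p.1.1, extendPath (A := fun s => ∀ i, Y s i × U s i) hn' p.1.2 p.2) :=
      Measurable.prodMk (by fun_prop) (measurable_extendPath hn' (by fun_prop) (by fun_prop))
    have hG : Measurable fun q : Omega X W₀ × Upto (fun s => ∀ i, Y s i × U s i) (n + 1) hn' =>
        F (toHistory q) * (dens φ (n + 1) hn' q.1 q.2 : ℝ≥0∞) :=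
      (hF.comp measurable_toHistory).mul (h.measurable_dens (n + 1) hn')
    refine le_trans (le_of_eq ?_) (hS π hπ t i)
    refine Eq.trans ?_ (h.lintegral_restrictHistory π hn' le_rfl hF).symm
    rw [h.lintegral_jointLaw π (n + 1) hn' hF, refLaw_succ, lintegral_map hG hap]
    refine lintegral_congr fun q => ?_
    simp only [toHistory_extendPath, dens_extendPath]
    have hFc : F (extendHistory hn' (toHistory q.1) q.2) = c t i (e (r q), (q.2 i).2) := by
      simp only [F, extendHistory, extendPath_last, extendPath_castSucc]
      rfl
    rw [hFc]
  have hsnd : IsTightMeasureSet (Measure.snd '' ((fun π => pairLaw ν π t i) '' S)) := by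
    rw [isTightMeasureSet_iff_exists_isCompact_measure_compl_le]
    intro ε hε
    obtain ⟨ε', hε'0, hε'⟩ : ∃ ε' : ℝ≥0, 0 < ε' ∧ (ε' : ℝ≥0∞) + ε' ≤ ε := by
      obtain ⟨ε', h1, h2⟩ := ENNReal.lt_iff_exists_nnreal_btwn.1 (ENNReal.half_pos hε.ne')
      refine ⟨ε', by exact_mod_cast h1, ?_⟩
      calc (ε' : ℝ≥0∞) + ε' ≤ ε / 2 + ε / 2 := add_le_add h2.le h2.le
        _ = ε := ENNReal.add_halves ε
    obtain ⟨K, hK, hKR⟩ := (isTightMeasureSet_iff_exists_isCompact_measure_compl_le.1 hR) ε'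
      (by exact_mod_cast hε'0)
    obtain ⟨δ, hδ, hδK⟩ := exists_pos_le_of_isCompact hd hdpos hK
    -- By Markov's inequality the action leaves `L` while `r q ∈ K` with probability at most
    -- `B / (M * δ)`, which this choice of `M` makes at most `ε'`.
    let M : ℝ≥0 := (B + 1) / (δ * ε')
    have hM : 0 < M := by positivity
    obtain ⟨L, hL, hLM⟩ := (hcIC t i).exists_isCompact hM (hK.image he)
    refine ⟨L, hL, ?_⟩
    rintro _ ⟨_, ⟨π, hπ, rfl⟩, rfl⟩
    have hproj : (P π).map (fun q => (q.2 i).2) = (pairLaw ν π t i).snd := by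
      have h3 : (P π).map Prod.snd = Measure.pi (pairLaw ν π t) := by simp [P]
      rw [Measure.snd, ← (measurePreserving_eval (pairLaw ν π t) i).map_eq, ← h3,
        Measure.map_map (by fun_prop) (by fun_prop), Measure.map_map (by fun_prop) (by fun_prop)]
      rfl
    rw [← hproj, Measure.map_apply (by fun_prop) hL.measurableSet.compl]
    have hsub : (fun q : (Omega X W₀ × Upto (fun s => ∀ i, Y s i × U s i) n hn.le) ×
        (∀ j, Y t j × U t j) => (q.2 i).2) ⁻¹' Lᶜ ⊆
        r ⁻¹' Kᶜ ∪ {q | ((M * δ : ℝ≥0) : ℝ≥0∞) ≤ f q} := by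
      intro q hq
      by_cases hqK : r q ∈ K
      · right
        have h4 := hLM _ (Set.mem_image_of_mem e hqK) _ hq
        have h5 := hδK _ hqK
        change ((M * δ : ℝ≥0) : ℝ≥0∞) ≤ (c t i (e (r q), (q.2 i).2) : ℝ≥0∞) * (d (r q) : ℝ≥0∞)
        exact_mod_cast mul_le_mul' h4 h5
      · exact Or.inl hqK
    refine (measure_mono hsub).trans ((measure_union_le _ _).trans (le_trans ?_ hε'))
    refine add_le_add ?_ ?_
    · rw [← Measure.map_apply hr hK.measurableSet.compl, hPR]
      exact hKR _ (Set.mem_image_of_mem _ hπ)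
    · have h6 := (mul_meas_ge_le_lintegral hf ((M * δ : ℝ≥0) : ℝ≥0∞)).trans (hcost π hπ)
      have hMδ : M * δ ≠ 0 := (mul_pos hM hδ).ne'
      have h7 : (B : ℝ≥0∞) ≤ ((M * δ : ℝ≥0) : ℝ≥0∞) * ε' := by
        rw [← ENNReal.coe_mul, ENNReal.coe_le_coe]
        have : M * δ * ε' = B + 1 := by
          simp only [M]; field_simp
        rw [this]
        exact le_self_add
      exact (ENNReal.mul_le_mul_iff_right (by exact_mod_cast hMδ) ENNReal.coe_ne_top).1
        (h6.trans h7)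
  refine IsTightMeasureSet.prodMk ?_ hsnd
  refine (isTightMeasureSet_singleton (μ := (ν t i : Measure (Y t i)))).subset ?_
  rintro _ ⟨_, ⟨π, -, rfl⟩, rfl⟩
  exact hfst π i

/-! ### Existence of an optimal profile and derandomization -/

/-- The cost of the equivalent static team, in which the observations are independent of each
other and of `ω₀`: the cost multiplied by the density of the observations. -/
def staticCost (D : DynamicTeam N T X U Y W₀ W) (φ : ∀ (t : Fin T) (i : Fin N),
      Y t i × Omega X W₀ × Upto (fun s => ∀ j, U s j) t t.2.le → ℝ≥0)
    (q : Omega X W₀ × Upto (fun s => ∀ i, Y s i × U s i) T le_rfl) : ℝ≥0 :=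
  D.redCost q.1 (yPart q.2) (uPart q.2) * dens φ T le_rfl q.1 q.2

/-- The expected cost of the static team as a function of the laws of the pairs. -/
noncomputable def staticJ (D : DynamicTeam N T X U Y W₀ W) (φ : ∀ (t : Fin T) (i : Fin N),
      Y t i × Omega X W₀ × Upto (fun s => ∀ j, U s j) t t.2.le → ℝ≥0)
    (μ : ∀ t i, Measure (Y t i × U t i)) : ℝ≥0∞ :=
  ∫⁻ q, (D.staticCost φ q : ℝ≥0∞) ∂(D.refLaw μ T le_rfl)

theorem HasObsDensity.expectedCost_eq (h : D.HasObsDensity ν φ)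
    (hc : Continuous fun p : History X W₀ Y U T le_rfl => D.redCost p.1 p.2.1 p.2.2)
    (π : Strategy Y U) : D.expectedCost π = D.staticJ φ (pairLaw ν π) := by
  rw [expectedCost, h.lintegral_jointLaw π T le_rfl hc.measurable.coe_nnreal_ennreal]
  refine lintegral_congr fun q => ?_
  rw [staticCost, ENNReal.coe_mul]
  rfl

theorem HasObsDensity.continuous_staticCost (h : D.HasObsDensity ν φ)
    (hc : Continuous fun p : History X W₀ Y U T le_rfl => D.redCost p.1 p.2.1 p.2.2) :
    Continuous (D.staticCost φ) :=
  (hc.comp (continuous_fst.prodMk ((continuous_yPart.comp continuous_snd).prodMk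
    (continuous_uPart.comp continuous_snd)))).mul (continuous_dens h.cont T le_rfl)

theorem HasObsDensity.lowerSemicontinuous_staticJ (h : D.HasObsDensity ν φ)
    (hc : Continuous fun p : History X W₀ Y U T le_rfl => D.redCost p.1 p.2.1 p.2.2) :
    LowerSemicontinuous fun μ : ∀ t i, ProbabilityMeasure (Y t i × U t i) =>
      D.staticJ φ fun t i => (μ t i : Measure (Y t i × U t i)) := by
  let ρ : ProbabilityMeasure (Omega X W₀) := ⟨D.omegaLaw, inferInstance⟩
  let P : (∀ t i, ProbabilityMeasure (Y t i × U t i)) →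
      ProbabilityMeasure (Omega X W₀ × Upto (fun s => ∀ i, Y s i × U s i) T le_rfl) := fun μ =>
    ρ.prod (ProbabilityMeasure.pi fun t => ProbabilityMeasure.pi (μ t))
  have hP : Continuous P := by
    have h1 : Continuous fun μ : ∀ t i, ProbabilityMeasure (Y t i × U t i) =>
        ProbabilityMeasure.pi fun t => ProbabilityMeasure.pi (μ t) :=
      ProbabilityMeasure.continuous_pi.comp (continuous_pi fun t =>
        ProbabilityMeasure.continuous_pi.comp (continuous_apply t))
    exact ProbabilityMeasure.continuous_prod.comp ((continuous_const (y := ρ)).prodMk h1)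
  exact (lowerSemicontinuous_lintegral_coe (h.continuous_staticCost hc)).comp hP

/-- Every family of laws of pairs with the right observation marginals comes from a behavioral
profile, by disintegration. -/
theorem exists_strategy_pairLaw_eq (μ : ∀ t i, ProbabilityMeasure (Y t i × U t i))
    (hμ : ∀ t i, (μ t i : Measure (Y t i × U t i)).fst = ν t i) :
    ∃ π : Strategy Y U, ∀ t i, pairLaw ν π t i = μ t i := by
  have hne : ∀ t i, Nonempty (U t i) := fun t i =>
    ⟨(nonempty_of_isProbabilityMeasure (μ t i : Measure (Y t i × U t i))).some.2⟩
  refine ⟨fun t i => ⟨(μ t i : Measure (Y t i × U t i)).condKernel, inferInstance⟩,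
    fun t i => ?_⟩
  rw [pairLaw, ← hμ]
  exact Measure.disintegrate _ _

/-- An optimal behavioral profile exists: the laws of the pairs that come from profiles of cost at
most `B` form a weakly compact set, on which the static expected cost is lower semicontinuous. -/
theorem HasObsDensity.exists_isTeamOptimal (h : D.HasObsDensity ν φ)
    (hc : Continuous fun p : History X W₀ Y U T le_rfl => D.redCost p.1 p.2.1 p.2.2)
    (hfin : ∃ π : Strategy Y U, D.expectedCost π < ⊤)
    {c : ∀ (t : Fin T) (i : Fin N),
      (Omega X W₀ × Upto (fun s => ∀ j, U s j) t t.2.le ×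
        Upto (fun s => ∀ j, Y s j) t t.2.le × Y t i) × U t i → ℝ≥0}
    (hccont : ∀ t i, Continuous (c t i)) (hcIC : ∀ t i, ClassIC (c t i))
    (hle : ∀ t i (p : History X W₀ Y U T le_rfl),
      c t i ((p.1, truncate p.2.2 t t.2.le, truncate p.2.1 t t.2.le, p.2.1 t i), p.2.2 t i) ≤
        D.redCost p.1 p.2.1 p.2.2) :
    ∃ π : Strategy Y U, D.IsTeamOptimal π := by
  obtain ⟨π₀, hπ₀⟩ := hfin
  obtain ⟨B, hB⟩ : ∃ B : ℝ≥0, (B : ℝ≥0∞) = D.expectedCost π₀ := ⟨_, ENNReal.coe_toNNReal hπ₀.ne⟩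
  let S : Set (Strategy Y U) := {π | D.expectedCost π ≤ B}
  have htight : ∀ t i, IsTightMeasureSet ((fun π => pairLaw ν π t i) '' S) :=
    h.isTightMeasureSet_pairLaw hccont hcIC fun π hπ t i =>
      (lintegral_mono fun p => ENNReal.coe_le_coe.2 (hle t i p)).trans hπ
  let pairPM : Strategy Y U → ∀ t i, ProbabilityMeasure (Y t i × U t i) := fun π t i =>
    ⟨pairLaw ν π t i, inferInstance⟩
  have hJpair : ∀ π, D.expectedCost π = D.staticJ φ fun t i => (pairPM π t i : Measure _) :=
    fun π => h.expectedCost_eq hc π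
  have hfst : ∀ π t i, (pairPM π t i : Measure (Y t i × U t i)).fst = ν t i := fun π t i =>
    Measure.fst_compProd _ _
  -- The constraint set: `ν`-marginals and expected cost at most `B`. By disintegration it consists
  -- of the laws of pairs of the profiles in `S`.
  let Q : Set (∀ t i, ProbabilityMeasure (Y t i × U t i)) :=
    {μ | (∀ t i, (μ t i).map measurable_fst.aemeasurable = ν t i) ∧
      D.staticJ φ (fun t i => (μ t i : Measure (Y t i × U t i))) ≤ B}
  have hlsc := h.lowerSemicontinuous_staticJ hc
  have hfst' : ∀ (μ : ∀ t i, ProbabilityMeasure (Y t i × U t i)) t i,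
      (μ t i).map measurable_fst.aemeasurable = ν t i ↔
        (μ t i : Measure (Y t i × U t i)).fst = ν t i := fun μ t i =>
    ⟨fun h => congrArg (fun ρ : ProbabilityMeasure _ => (ρ : Measure (Y t i))) h,
      fun h => Subtype.ext h⟩
  have hmem : ∀ π, D.expectedCost π ≤ B → pairPM π ∈ Q := fun π hπ =>
    ⟨fun t i => (hfst' _ t i).2 (hfst π t i), (hJpair π).symm.le.trans hπ⟩
  have hrep : ∀ μ ∈ Q, ∃ π : Strategy Y U, pairPM π = μ := by
    intro μ hμ
    obtain ⟨π, hπ⟩ := exists_strategy_pairLaw_eq μ fun t i => (hfst' μ t i).1 (hμ.1 t i)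
    exact ⟨π, funext fun t => funext fun i => Subtype.ext (hπ t i)⟩
  have hQclosed : IsClosed Q := by
    have h1 : IsClosed {μ : ∀ t i, ProbabilityMeasure (Y t i × U t i) |
        ∀ t i, (μ t i).map measurable_fst.aemeasurable = ν t i} := by
      simp only [Set.ofPred_forall]
      refine isClosed_iInter fun t => isClosed_iInter fun i => isClosed_eq ?_ continuous_const
      exact (ProbabilityMeasure.continuous_map continuous_fst).comp
        ((continuous_apply i).comp (continuous_apply t))
    exact h1.inter (hlsc.isClosed_preimage _)
  have hQcompact : IsCompact Q := by
    have hcpt : ∀ t i, IsCompact (closure ((fun π => pairPM π t i) '' S)) := fun t i => by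
      refine isCompact_closure_of_isTightMeasureSet ((htight t i).subset ?_)
      rintro _ ⟨_, ⟨π, hπ, rfl⟩, rfl⟩
      exact ⟨π, hπ, rfl⟩
    refine (isCompact_univ_pi fun t => isCompact_univ_pi (hcpt t)).of_isClosed_subset hQclosed ?_
    intro μ hμ t _ i _
    obtain ⟨π, rfl⟩ := hrep μ hμ
    exact subset_closure ⟨π, (hJpair π).le.trans hμ.2, rfl⟩
  obtain ⟨μ, hμ, hmin⟩ := LowerSemicontinuousOn.exists_isMinOn
    ⟨_, hmem π₀ hB.symm.le⟩ hQcompact (hlsc.lowerSemicontinuousOn Q)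
  obtain ⟨π, rfl⟩ := hrep μ hμ
  refine ⟨π, fun π' => ?_⟩
  by_cases hπ' : D.expectedCost π' ≤ B
  · rw [hJpair, hJpair]
    exact hmin (hmem π' hπ')
  · exact ((hJpair π).le.trans hμ.2).trans (not_le.1 hπ').le

/-- Randomization does not help: a behavioral profile has the same cost as `u t i = f t i (y t i) ξ`
with independent uniform `ξ`, one for each agent and time. Its cost is therefore an average of costs
of deterministic profiles, one of which is at most the average. -/
theorem HasObsDensity.exists_deterministic_le (h : D.HasObsDensity ν φ)
    (hc : Continuous fun p : History X W₀ Y U T le_rfl => D.redCost p.1 p.2.1 p.2.2)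
    (π : Strategy Y U) :
    ∃ (γ : ∀ t i, Y t i → U t i) (hγ : ∀ t i, Measurable (γ t i)),
      D.expectedCost (Strategy.ofDeterministic γ hγ) ≤ D.expectedCost π := by
  let 𝒩 : Measure (∀ t i, Y t i) :=
    Measure.pi fun t => Measure.pi fun i => (ν t i : Measure (Y t i))
  let Λ : Measure (Fin T → Fin N → unitInterval) := Measure.pi fun _ => Measure.pi fun _ => volume
  have hne : ∀ t i, Nonempty (U t i) := fun t i =>
    ⟨(nonempty_of_isProbabilityMeasure (pairLaw ν π t i)).some.2⟩
  have hexists := fun t i => Kernel.exists_measurable_map_eq_unitInterval (π t i).1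
  choose f hf hfπ using hexists
  have hfξ : ∀ (ξ : Fin T → Fin N → unitInterval) t i, Measurable fun y => f t i y (ξ t i) :=
    fun ξ t i => (hf t i).comp measurable_prodMk_right
  -- the path of pairs produced by the observations and the private randomization
  let e : (∀ t i, Y t i) × (Fin T → Fin N → unitInterval) →
      Upto (fun s => ∀ i, Y s i × U s i) T le_rfl :=
    fun p t i => (p.1 t i, f t i (p.1 t i) (p.2 t i))
  have he : Measurable e := by
    refine measurable_pi_lambda _ fun t => measurable_pi_lambda _ fun i =>
      Measurable.prodMk (by fun_prop) ?_
    exact (hf t i).comp (Measurable.prodMk (by fun_prop) (by fun_prop))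
  let G : Omega X W₀ → (∀ t i, Y t i) → (Fin T → Fin N → unitInterval) → ℝ≥0∞ :=
    fun ω y ξ => (D.staticCost φ (ω, e (y, ξ)) : ℝ≥0∞)
  have hcost := (h.continuous_staticCost hc).measurable.coe_nnreal_ennreal
  have hcostω : ∀ ω, Measurable fun z => (D.staticCost φ (ω, z) : ℝ≥0∞) := fun ω =>
    hcost.comp measurable_prodMk_left
  have hG : Measurable fun p : Omega X W₀ × (∀ t i, Y t i) × (Fin T → Fin N → unitInterval) =>
      G p.1 p.2.1 p.2.2 :=
    hcost.comp (measurable_fst.prodMk (he.comp measurable_snd))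
  have hpi : Measure.pi (fun t => Measure.pi (pairLaw ν π t)) = (𝒩.prod Λ).map e := by
    have h1 : ∀ t, Measure.pi (pairLaw ν π t) =
        ((Measure.pi fun i => (ν t i : Measure (Y t i))).prod
          (Measure.pi fun _ : Fin N => (volume : Measure unitInterval))).map
          fun p i => (p.1 i, f t i (p.1 i) (p.2 i)) := by
      intro t
      have h2 : pairLaw ν π t = fun i => ((ν t i : Measure (Y t i)).prod volume).map
          fun p => (p.1, f t i p.1 p.2) :=
        funext fun i => compProd_eq_map_prod _ _ _ (hf t i) (hfπ t i)
      rw [h2]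
      exact pi_map_prod _ _ fun i => measurable_fst.prodMk (hf t i)
    simp_rw [h1]
    refine pi_map_prod _ _ fun t => measurable_pi_lambda _ fun i =>
      Measurable.prodMk (by fun_prop) ?_
    exact (hf t i).comp (Measurable.prodMk (by fun_prop) (by fun_prop))
  have hJ : D.expectedCost π = ∫⁻ ξ, ∫⁻ ω, ∫⁻ y, G ω y ξ ∂𝒩 ∂D.omegaLaw ∂Λ := by
    rw [h.expectedCost_eq hc, staticJ, refLaw, lintegral_prod _ hcost.aemeasurable]
    have h1 : ∀ ω, ∫⁻ z, (D.staticCost φ (ω, z) : ℝ≥0∞)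
        ∂(Measure.pi fun t => Measure.pi (pairLaw ν π t)) = ∫⁻ ξ, ∫⁻ y, G ω y ξ ∂𝒩 ∂Λ := by
      intro ω
      refine (congrArg (fun m => ∫⁻ z, (D.staticCost φ (ω, z) : ℝ≥0∞) ∂m) hpi).trans ?_
      refine (lintegral_map (hcostω ω) he).trans ?_
      exact lintegral_prod_symm' _ (hG.comp measurable_prodMk_left)
    refine (lintegral_congr h1).trans ?_
    refine lintegral_lintegral_swap (Measurable.aemeasurable ?_)
    refine Measurable.lintegral_prod_right' (f := fun q : (Omega X W₀ ×
      (Fin T → Fin N → unitInterval)) × (∀ t i, Y t i) => G q.1.1 q.2 q.1.2) ?_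
    have hperm : Measurable fun q : (Omega X W₀ × (Fin T → Fin N → unitInterval)) ×
      (∀ t i, Y t i) => (q.1.1, q.2, q.1.2) := by fun_prop
    exact hG.comp hperm
  have hJξ : ∀ ξ, D.expectedCost (Strategy.ofDeterministic (fun t i y => f t i y (ξ t i))
      (hfξ ξ)) = ∫⁻ ω, ∫⁻ y, G ω y ξ ∂𝒩 ∂D.omegaLaw := by
    intro ξ
    rw [h.expectedCost_eq hc, staticJ, refLaw, lintegral_prod _ hcost.aemeasurable]
    refine lintegral_congr fun ω => ?_
    have heξ : Measurable fun y => e (y, ξ) := he.comp measurable_prodMk_right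
    have hpiξ : Measure.pi (fun t => Measure.pi (pairLaw ν (Strategy.ofDeterministic
        (fun t i y => f t i y (ξ t i)) (hfξ ξ)) t)) = 𝒩.map fun y => e (y, ξ) := by
      have h1 : ∀ t i, pairLaw ν (Strategy.ofDeterministic
          (fun t i y => f t i y (ξ t i)) (hfξ ξ)) t i =
          (ν t i : Measure (Y t i)).map fun y => (y, f t i y (ξ t i)) := fun t i =>
        Measure.compProd_deterministic (hfξ ξ t i)
      have hm : ∀ t i, Measurable fun y => (y, f t i y (ξ t i)) := fun t i =>
        measurable_id.prodMk (hfξ ξ t i)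
      have hp1 : ∀ t i, IsProbabilityMeasure
          ((ν t i : Measure (Y t i)).map fun y => (y, f t i y (ξ t i))) := fun t i =>
        Measure.isProbabilityMeasure_map (hm t i).aemeasurable
      have h2 : ∀ t, Measure.pi (pairLaw ν (Strategy.ofDeterministic
          (fun t i y => f t i y (ξ t i)) (hfξ ξ)) t) =
          (Measure.pi fun i => (ν t i : Measure (Y t i))).map
            fun y i => (y i, f t i (y i) (ξ t i)) := by
        intro t
        rw [Measure.pi_map_pi fun i => (hm t i).aemeasurable]
        exact congrArg _ (funext fun i => h1 t i)
      have hm2 : ∀ t, Measurable fun (y : ∀ i, Y t i) i => (y i, f t i (y i) (ξ t i)) := fun t =>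
        measurable_pi_lambda _ fun i => (hm t i).comp (measurable_pi_apply i)
      have hp2 : ∀ t, IsProbabilityMeasure ((Measure.pi fun i => (ν t i : Measure (Y t i))).map
            fun y i => (y i, f t i (y i) (ξ t i))) := fun t =>
        Measure.isProbabilityMeasure_map (hm2 t).aemeasurable
      simp_rw [h2]
      rw [← Measure.pi_map_pi fun t => (hm2 t).aemeasurable]
    exact (congrArg (fun m => ∫⁻ z, (D.staticCost φ (ω, z) : ℝ≥0∞) ∂m) hpiξ).trans
      (lintegral_map (hcostω ω) heξ)
  have hmeas : Measurable fun ξ => ∫⁻ ω, ∫⁻ y, G ω y ξ ∂𝒩 ∂D.omegaLaw := by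
    refine Measurable.lintegral_prod_right' (f := fun q : (Fin T → Fin N → unitInterval) ×
      Omega X W₀ => ∫⁻ y, G q.2 y q.1 ∂𝒩) ?_
    refine Measurable.lintegral_prod_right' (f := fun q : ((Fin T → Fin N → unitInterval) ×
      Omega X W₀) × (∀ t i, Y t i) => G q.1.2 q.2 q.1.1) ?_
    have hperm : Measurable fun q : ((Fin T → Fin N → unitInterval) × Omega X W₀) ×
      (∀ t i, Y t i) => (q.1.2, q.2, q.1.1) := by fun_prop
    exact hG.comp hperm
  obtain ⟨ξ, hξ⟩ := exists_le_lintegral (μ := Λ) hmeas.aemeasurable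
  exact ⟨_, hfξ ξ, by rw [hJ, hJξ]; exact hξ⟩

end Reduction

end DynamicTeam

theorem mainTheorem1 {N T : ℕ}
    {X : Fin (T + 1) → Type*} {U Y : Fin T → Fin N → Type*}
    {W₀ : Fin T → Type*} {W : Fin T → Fin N → Type*}
    [∀ s, TopologicalSpace (X s)] [∀ s, PolishSpace (X s)]
    [∀ s, MeasurableSpace (X s)] [∀ s, BorelSpace (X s)]
    [∀ t i, TopologicalSpace (U t i)] [∀ t i, PolishSpace (U t i)]
    [∀ t i, MeasurableSpace (U t i)] [∀ t i, BorelSpace (U t i)]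
    [∀ t i, TopologicalSpace (Y t i)] [∀ t i, PolishSpace (Y t i)]
    [∀ t i, MeasurableSpace (Y t i)] [∀ t i, BorelSpace (Y t i)]
    [∀ t, TopologicalSpace (W₀ t)] [∀ t, PolishSpace (W₀ t)]
    [∀ t, MeasurableSpace (W₀ t)] [∀ t, BorelSpace (W₀ t)]
    [∀ t i, TopologicalSpace (W t i)] [∀ t i, PolishSpace (W t i)]
    [∀ t i, MeasurableSpace (W t i)] [∀ t i, BorelSpace (W t i)]
    (D : DynamicTeam N T X U Y W₀ W)
    -- continuous dynamics, observations and cost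
    (hcont : D.IsContinuous)
    -- some behavioral strategy profile has finite expected cost
    (hfin : ∃ π : DynamicTeam.Strategy Y U, D.expectedCost π < ⊤)
    -- observation kernels with continuous, strictly positive densities
    (ν : ∀ t i, ProbabilityMeasure (Y t i))
    (φ : ∀ (t : Fin T) (i : Fin N),
      Y t i × DynamicTeam.Omega X W₀ × Upto (fun s => ∀ j, U s j) t t.2.le → ℝ≥0)
    (hφcont : ∀ t i, Continuous (φ t i))
    (hφpos : ∀ t i p, 0 < φ t i p)
    (hφ : ∀ (t : Fin T) (i : Fin N) (ω : DynamicTeam.Omega X W₀)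
      (u : Upto (fun s => ∀ j, U s j) t t.2.le) (S : Set (Y t i)), MeasurableSet S →
      D.obsLaw t i ω u S = ∫⁻ y in S, (φ t i (y, ω, u) : ℝ≥0∞) ∂(ν t i : Measure (Y t i)))
    -- structure of the cost: coercive terms plus a non-negative continuous remainder
    (c : ∀ (t : Fin T) (i : Fin N),
      (DynamicTeam.Omega X W₀ × Upto (fun s => ∀ j, U s j) t t.2.le ×
        Upto (fun s => ∀ j, Y s j) t t.2.le × Y t i) × U t i → ℝ≥0)
    (hccont : ∀ t i, Continuous (c t i))
    (hcIC : ∀ t i, ClassIC (c t i))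
    (κ : DynamicTeam.Omega X W₀ × (∀ t i, Y t i) × (∀ t i, U t i) → ℝ≥0)
    (hκcont : Continuous κ)
    (hcost : ∀ (ω : DynamicTeam.Omega X W₀) (y : ∀ t i, Y t i) (u : ∀ t i, U t i),
      D.redCost ω y u =
        (∑ t : Fin T, ∑ i : Fin N,
          c t i ((ω, truncate u t t.2.le, truncate y t t.2.le, y t i), u t i)) + κ (ω, y, u)) :
    ∃ (γ : ∀ t i, Y t i → U t i) (hγ : ∀ t i, Measurable (γ t i)),
      D.IsTeamOptimal (DynamicTeam.Strategy.ofDeterministic γ hγ) := by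
  have hD : D.HasObsDensity ν φ := by
    refine ⟨hφcont, hφpos, fun t i ω u => ?_, hφ⟩
    refine Measure.isProbabilityMeasure_map (Continuous.measurable ?_).aemeasurable
    exact (hcont.obs t i).comp
      (continuous_const.prodMk (continuous_const.prodMk continuous_id))
  have hterm : ∀ t i, Continuous fun p : DynamicTeam.History X W₀ Y U T le_rfl =>
      c t i ((p.1, truncate p.2.2 t t.2.le, truncate p.2.1 t t.2.le, p.2.1 t i), p.2.2 t i) := by
    intro t i
    have hY : Continuous fun p : DynamicTeam.History X W₀ Y U T le_rfl => p.2.1 t i :=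
      (continuous_apply i).comp ((continuous_apply t).comp (continuous_fst.comp continuous_snd))
    have hU : Continuous fun p : DynamicTeam.History X W₀ Y U T le_rfl => p.2.2 t i :=
      (continuous_apply i).comp ((continuous_apply t).comp (continuous_snd.comp continuous_snd))
    refine (hccont t i).comp (Continuous.prodMk (continuous_fst.prodMk
      (Continuous.prodMk ?_ (Continuous.prodMk ?_ hY))) hU)
    · exact continuous_pi fun s => (continuous_apply _).comp (continuous_snd.comp continuous_snd)
    · exact continuous_pi fun s => (continuous_apply _).comp (continuous_fst.comp continuous_snd)
  have hc : Continuous fun p : DynamicTeam.History X W₀ Y U T le_rfl =>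
      D.redCost p.1 p.2.1 p.2.2 := by
    simp_rw [hcost]
    exact (continuous_finsetSum _ fun t _ => continuous_finsetSum _ fun i _ => hterm t i).add hκcont
  have hle : ∀ t i (p : DynamicTeam.History X W₀ Y U T le_rfl),
      c t i ((p.1, truncate p.2.2 t t.2.le, truncate p.2.1 t t.2.le, p.2.1 t i), p.2.2 t i) ≤
        D.redCost p.1 p.2.1 p.2.2 := by
    intro t i p
    rw [hcost]
    refine le_add_right ?_
    refine le_trans ?_ (Finset.single_le_sum (fun _ _ => zero_le) (Finset.mem_univ t))
    exact Finset.single_le_sum (f := fun i => c t i ((p.1, truncate p.2.2 t t.2.le,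
      truncate p.2.1 t t.2.le, p.2.1 t i), p.2.2 t i)) (fun _ _ => zero_le) (Finset.mem_univ i)
  obtain ⟨π, hπ⟩ := hD.exists_isTeamOptimal hc hfin hccont hcIC hle
  obtain ⟨γ, hγ, hγπ⟩ := hD.exists_deterministic_le hc π
  exact ⟨γ, hγ, fun π' => hγπ.trans (hπ π')⟩
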